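/- Let $\mathbb K$ be a field, and let $\Gamma$ be a positive monoid with neutral element $\epsilon$, that is, $\gamma_1\gamma_2=\epsilon$ implies $\gamma_1=\gamma_2=\epsilon$ (for instance, an ordered monoid whose least element is $\epsilon$). Let $S$ be a set on which $\Gamma$ acts from the left, effectively in the sense that $\gamma_1x\neq\gamma_2x$ for all $x\in S$ and all $\gamma_1\ne\gamma_2$ in $\Gamma$. **The algebras $C(X)$.** Let $A=\bigoplus_{\gamma\in\Gamma}A_\gamma$ be an associative unital $\Gamma$-graded $\mathbb K$-algebra. Let $C$ be the skew product $A\ltimes_\Gamma \mathrm{Maps}(S,\mathbb K)$: the vector space $A\otimes_{\mathbb K}\mathrm{Maps}(S,\mathbb K)$ with the multiplication $(a\otimes b)(a'\otimes b')=aa'\otimes b^{\gamma}b'$ for $a'\in A_\gamma$, where $b^\gamma(x)=b(\gamma x)$. For $T\subset S$ let $\chi_T$ be the characteristic function of $T$, also regarded as the idempotent $1\otimes\chi_T$; write $\chi_x=\chi_{\{x\}}$. For $X\subset S$ put $C(X)=C/C\chi_{S\setminus X}C$. The images of $a\otimes \chi_T$ and of $\chi_T$ in $C(X)$ are denoted by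 the same symbols. **The factorization.** Suppose that $A=A_1\otimes A_2$ is a product of two $\Gamma$-graded algebras, that is, there are homomorphisms of graded algebras $A_1\to A$ and $A_2\to A$ such that $a_1\otimes a_2\mapsto a_1a_2$ is a bijection $A_1\otimes_{\mathbb K} A_2\to A$. (The elements of $A_1$ and $A_2$ need not commute.) For $i=1,2$ let $\Gamma_i$ be a submonoid of $\Gamma$ such that $(A_i)_\gamma=0$ for $\gamma\notin\Gamma_i$, and let $J_i$ be a homogeneous basis of $A_i$. Let $C_2(Y)$ be the algebra constructed as above from $A_2$ in place of $A$. **Hypotheses.** Let $X\subset Y$ be subsets of $S$ and $Z=Y\setminus X$. Suppose that there are subsets $I_y\subset J_2$ for $y\in Y$ such that the family $$(a\otimes\chi_y),\qquad y\in Y,\ a\in I_y,$$ is a basis of $C_2(Y)$, and the family $$(a_1a_2\otimes\chi_y),\qquad y\in Y,\ a_1\in J_1,\ a_2\in I_y,\ \deg(a_1)\deg(a_2)y\in Y,$$ is a basis of $C(Y)$. Suppose that $\Gamma_1X\cap Y=X$ and $\Gamma_2Z\cap Y=Z$. Suppose finally that $Z=\{z_1,\dots,z_m\}$ with pairwise distinct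 $z_i$ such that, for all $i\neq j$, 1. if $z_j\in\Gamma_2 z_i$ (that is, $z_i\le_{\Gamma_2}z_j$), then $i<j$; 2. if $z_j\in\Gamma_1 z_i$ (that is, $z_i\le_{\Gamma_1}z_j$), then $j<i$. For $1\le k\le m$ put $X_k=X\cup\{z_1,\dots,z_k\}$ and $e_k=\chi_{z_k}\in C(X_k)$. **Definitions.** A two-sided ideal $I$ of a ring $R$ is $k$-idempotent if $\operatorname{Ext}^i_R(R/I,M)=0$ for all $R/I$-modules $M$ and all $1\le i\le k$; it is strong idempotent if it is $k$-idempotent for every $k$. For an idempotent $e\in R$, the ideal $ReR$ is a heredity ideal if $e\operatorname{Rad}(R)e=0$ and $ReR$ is projective as a left $R$-module, where $\operatorname{Rad}$ denotes the Jacobson radical. **Claim.** For every $1\le k\le m$ the ideal $C(X_k)e_kC(X_k)$ of $C(X_k)$ is $2$-idempotent. If, in addition, the ring $A_\epsilon/\operatorname{Rad}(A_\epsilon)$ is semisimple and $\operatorname{Rad}(A_\epsilon)=0$, then $C(X_k)e_kC(X_k)$ is a heredity ideal of $C(X_k)$ for every $1\le k\le m$, and the ideal $C(Y)\chi_ZC(Y)$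 of $C(Y)$ is strong idempotent. -/

import Mathlib

open scoped TensorProduct DirectSum Pointwise

/-! ### Skew products over a monoid

The monoid `Γ` is not assumed commutative; it is written additively, with neutral element `0`, in
order to use Mathlib's graded algebras. -/

/-- A right action of the monoid `Γ` on the algebra `B` by algebra endomorphisms `b ↦ b ^ γ`. -/
structure GammaAlgebra (Γ K B : Type*) [AddMonoid Γ] [CommSemiring K] [Semiring B]
    [Algebra K B] where
  act : Γ → B →ₐ[K] B
  act_zero : ∀ b, act 0 b = b
  act_add : ∀ γ₁ γ₂ b, act (γ₁ + γ₂) b = act γ₂ (act γ₁ b)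

section Skew

variable {Γ K A B : Type*} [DecidableEq Γ] [AddMonoid Γ] [Field K] [Ring A] [Algebra K A]
  [Ring B] [Algebra K B] (𝒜 : Γ → Submodule K A) [GradedAlgebra 𝒜] (ρ : GammaAlgebra Γ K B)

/-- The interchange map `B ⊗ A → A ⊗ B`, `b ⊗ a ↦ a ⊗ b ^ γ` for `a` of degree `γ`. -/
noncomputable def interchange : B ⊗[K] A →ₗ[K] A ⊗[K] B :=
  TensorProduct.lift
    (((DirectSum.toModule K Γ (B →ₗ[K] A ⊗[K] B) fun γ =>
        (((LinearMap.lcomp K (A ⊗[K] B) (ρ.act γ).toLinearMap) ∘ₗ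
          (TensorProduct.mk K A B)) ∘ₗ (𝒜 γ).subtype)) ∘ₗ
      (DirectSum.decomposeLinearEquiv 𝒜).toLinearMap).flip)

theorem interchange_tmul {γ : Γ} {a : A} (ha : a ∈ 𝒜 γ) (b : B) :
    interchange 𝒜 ρ (b ⊗ₜ a) = a ⊗ₜ ρ.act γ b := by
  lift a to 𝒜 γ using ha
  simp [interchange]

/-- The multiplication of the skew product:
`(a ⊗ b) (a' ⊗ b') = a a' ⊗ b ^ γ b'` for `a'` of degree `γ`. -/
noncomputable def skewMul : (A ⊗[K] B) ⊗[K] (A ⊗[K] B) →ₗ[K] A ⊗[K] B :=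
  TensorProduct.map (LinearMap.mul' K A) (LinearMap.mul' K B) ∘ₗ
    (TensorProduct.assoc K A A (B ⊗[K] B)).symm.toLinearMap ∘ₗ
    LinearMap.lTensor A ((TensorProduct.assoc K A B B).toLinearMap ∘ₗ
      LinearMap.rTensor B (interchange 𝒜 ρ) ∘ₗ
      (TensorProduct.assoc K B A B).symm.toLinearMap) ∘ₗ
    (TensorProduct.assoc K A B (A ⊗[K] B)).toLinearMap

theorem skewMul_tmul {γ : Γ} (a : A) (b : B) {a' : A} (ha' : a' ∈ 𝒜 γ) (b' : B) :
    skewMul 𝒜 ρ ((a ⊗ₜ b) ⊗ₜ (a' ⊗ₜ b')) = (a * a') ⊗ₜ (ρ.act γ b * b') := by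
  simp [skewMul, interchange_tmul 𝒜 ρ ha']

/-- Induction on the elements of `A ⊗ B` through homogeneous pure tensors. -/
theorem skew_induction {P : A ⊗[K] B → Prop} (h0 : P 0) (hadd : ∀ x y, P x → P y → P (x + y))
    (h : ∀ (γ : Γ) (a : A), a ∈ 𝒜 γ → ∀ b : B, P (a ⊗ₜ b)) (x : A ⊗[K] B) : P x := by
  induction x using TensorProduct.induction_on with
  | zero => exact h0
  | add x y hx hy => exact hadd x y hx hy
  | tmul a b =>
    induction a using DirectSum.Decomposition.inductionOn 𝒜 with
    | zero => simpa using h0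
    | @homogeneous i m => exact h i m m.2 b
    | add m m' hm hm' => rw [TensorProduct.add_tmul]; exact hadd _ _ hm hm'

theorem skewMul_one_left (x : A ⊗[K] B) : skewMul 𝒜 ρ ((1 ⊗ₜ 1) ⊗ₜ x) = x := by
  induction x using skew_induction 𝒜 with
  | h0 => rw [TensorProduct.tmul_zero, map_zero]
  | hadd x y hx hy => rw [TensorProduct.tmul_add, map_add, hx, hy]
  | h γ a ha b => rw [skewMul_tmul 𝒜 ρ _ _ ha]; simp

theorem skewMul_one_right (x : A ⊗[K] B) : skewMul 𝒜 ρ (x ⊗ₜ (1 ⊗ₜ 1)) = x := by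
  induction x using skew_induction 𝒜 with
  | h0 => rw [TensorProduct.zero_tmul, map_zero]
  | hadd x y hx hy => rw [TensorProduct.add_tmul, map_add, hx, hy]
  | h γ a ha b =>
    rw [skewMul_tmul 𝒜 ρ _ _ (SetLike.GradedOne.one_mem (A := 𝒜))]; simp [ρ.act_zero]

theorem skewMul_assoc (x y z : A ⊗[K] B) :
    skewMul 𝒜 ρ (skewMul 𝒜 ρ (x ⊗ₜ y) ⊗ₜ z) = skewMul 𝒜 ρ (x ⊗ₜ skewMul 𝒜 ρ (y ⊗ₜ z)) := by
  induction x using skew_induction 𝒜 with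
  | h0 => simp only [TensorProduct.zero_tmul, map_zero]
  | hadd x x' hx hx' => simp only [TensorProduct.add_tmul, map_add, hx, hx']
  | h γ₁ a₁ h₁ b₁ =>
    induction y using skew_induction 𝒜 with
    | h0 => simp only [TensorProduct.zero_tmul, TensorProduct.tmul_zero, map_zero]
    | hadd y y' hy hy' =>
      simp only [TensorProduct.add_tmul, TensorProduct.tmul_add, map_add, hy, hy']
    | h γ₂ a₂ h₂ b₂ =>
      induction z using skew_induction 𝒜 with
      | h0 => simp only [TensorProduct.tmul_zero, map_zero]
      | hadd z z' hz hz' => simp only [TensorProduct.tmul_add, map_add, hz, hz']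
      | h γ₃ a₃ h₃ b₃ =>
        rw [skewMul_tmul 𝒜 ρ _ _ h₂, skewMul_tmul 𝒜 ρ _ _ h₃, skewMul_tmul 𝒜 ρ _ _ h₃,
          skewMul_tmul 𝒜 ρ _ _ (SetLike.GradedMul.mul_mem h₂ h₃)]
        simp only [map_mul, ρ.act_add, mul_assoc]

theorem skewMul_smul_left (r : K) (x y : A ⊗[K] B) :
    skewMul 𝒜 ρ ((r • x) ⊗ₜ y) = r • skewMul 𝒜 ρ (x ⊗ₜ y) := by
  rw [← TensorProduct.smul_tmul', map_smul]

theorem skewMul_smul_right (r : K) (x y : A ⊗[K] B) :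
    skewMul 𝒜 ρ (x ⊗ₜ (r • y)) = r • skewMul 𝒜 ρ (x ⊗ₜ y) := by
  rw [TensorProduct.tmul_smul, map_smul]

/-- The skew product `A ⋉ B` of the graded algebra `A` and the `Γ`-algebra `B`: the space `A ⊗ B`
with the multiplication `skewMul`. -/
@[nolint unusedArguments]
def SkewProduct (_𝒜 : Γ → Submodule K A) (_ρ : GammaAlgebra Γ K B) : Type _ := A ⊗[K] B

namespace SkewProduct

noncomputable instance : AddCommGroup (SkewProduct 𝒜 ρ) := inferInstanceAs (AddCommGroup (A ⊗[K] B))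

noncomputable instance : Module K (SkewProduct 𝒜 ρ) := inferInstanceAs (Module K (A ⊗[K] B))

/-- The element `a ⊗ b` of the skew product. -/
noncomputable def tmul (a : A) (b : B) : SkewProduct 𝒜 ρ := (a ⊗ₜ[K] b : A ⊗[K] B)

noncomputable instance : Ring (SkewProduct 𝒜 ρ) where
  __ := (inferInstance : AddCommGroup (SkewProduct 𝒜 ρ))
  mul (x y : A ⊗[K] B) := skewMul 𝒜 ρ (x ⊗ₜ y)
  one := ((1 : A) ⊗ₜ[K] (1 : B) : A ⊗[K] B)
  left_distrib (x y z : A ⊗[K] B) :=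
    (congrArg (skewMul 𝒜 ρ) (TensorProduct.tmul_add x y z)).trans (map_add _ _ _)
  right_distrib (x y z : A ⊗[K] B) :=
    (congrArg (skewMul 𝒜 ρ) (TensorProduct.add_tmul x y z)).trans (map_add _ _ _)
  zero_mul (x : A ⊗[K] B) :=
    (congrArg (skewMul 𝒜 ρ) (TensorProduct.zero_tmul _ x)).trans (map_zero _)
  mul_zero (x : A ⊗[K] B) :=
    (congrArg (skewMul 𝒜 ρ) (TensorProduct.tmul_zero _ x)).trans (map_zero _)
  one_mul := skewMul_one_left 𝒜 ρ
  mul_one := skewMul_one_right 𝒜 ρ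
  mul_assoc := skewMul_assoc 𝒜 ρ

theorem tmul_mul_tmul {γ : Γ} (a : A) (b : B) {a' : A} (ha' : a' ∈ 𝒜 γ) (b' : B) :
    tmul 𝒜 ρ a b * tmul 𝒜 ρ a' b' = tmul 𝒜 ρ (a * a') (ρ.act γ b * b') :=
  skewMul_tmul 𝒜 ρ a b ha' b'

noncomputable instance : Algebra K (SkewProduct 𝒜 ρ) :=
  Algebra.ofModule (skewMul_smul_left 𝒜 ρ) (skewMul_smul_right 𝒜 ρ)

end SkewProduct

end Skew

/-! ### The algebras `C(X)` -/

/-- The algebra `Maps(S, K)` of all functions on the `Γ`-set `S`, with `(b ^ γ) x = b (γ x)`. -/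
def mapsGammaAlgebra (Γ K S : Type*) [AddMonoid Γ] [Field K] [AddAction Γ S] :
    GammaAlgebra Γ K (S → K) where
  act γ :=
    { toFun := fun b x => b (γ +ᵥ x)
      map_one' := rfl
      map_mul' := fun _ _ => rfl
      map_zero' := rfl
      map_add' := fun _ _ => rfl
      commutes' := fun _ => rfl }
  act_zero b := funext fun x => congrArg b (zero_vadd Γ x)
  act_add γ₁ γ₂ b := funext fun x => congrArg b (add_vadd γ₁ γ₂ x)

theorem mapsGammaAlgebra_act_apply {Γ K S : Type*} [AddMonoid Γ] [Field K] [AddAction Γ S]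
    (γ : Γ) (b : S → K) (x : S) : (mapsGammaAlgebra Γ K S).act γ b x = b (γ +ᵥ x) := rfl

/-- The two-sided ideal `R e R` generated by `e`. -/
def idealGen {R : Type*} [Ring R] (e : R) : Ideal R := Ideal.span {e} * ⊤

instance {R : Type*} [Ring R] (e : R) : (idealGen e).IsTwoSided :=
  inferInstanceAs (Ideal.span {e} * ⊤ : Ideal R).IsTwoSided

section CX

variable {Γ K A : Type*} [DecidableEq Γ] [AddMonoid Γ] [Field K] [Ring A] [Algebra K A]
  (𝒜 : Γ → Submodule K A) [GradedAlgebra 𝒜] {S : Type*} [AddAction Γ S]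

/-- The skew product `C = A ⋉ Maps(S, K)`. -/
abbrev SkewC (𝒜 : Γ → Submodule K A) (S : Type*) [AddAction Γ S] : Type _ :=
  SkewProduct 𝒜 (mapsGammaAlgebra Γ K S)

/-- The element `a χ_X = a ⊗ χ_X` of `C`. -/
noncomputable def tmulChi (a : A) (X : Set S) : SkewC 𝒜 S :=
  SkewProduct.tmul 𝒜 (mapsGammaAlgebra Γ K S) a (X.indicator 1)

/-- The algebra `C(X) = C / C χ_{S ∖ X} C`. -/
abbrev CAlg (X : Set S) : Type _ := SkewC 𝒜 S ⧸ idealGen (tmulChi 𝒜 1 Xᶜ)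

/-- The image of `a χ_T` in `C(X)`. -/
noncomputable def CAlg.chi (X : Set S) (a : A) (T : Set S) : CAlg 𝒜 X :=
  Ideal.Quotient.mk _ (tmulChi 𝒜 a T)

end CX

/-- `y = γ x` for some `γ` in the submonoid `Γ'`. -/
def SubmonoidLE {Γ S : Type*} [AddMonoid Γ] [AddAction Γ S] (Γ' : AddSubmonoid Γ) (x y : S) :
    Prop :=
  ∃ γ ∈ Γ', y = γ +ᵥ x

/-- The family `v` is a basis of the vector space `M`. -/
def IsBasisFamily (K : Type*) {M ι : Type*} [Field K] [AddCommGroup M] [Module K M] (v : ι → M) :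
    Prop :=
  LinearIndependent K v ∧ Submodule.span K (Set.range v) = ⊤

/-- The graded algebra `A` is the product `A₁ ⊗ A₂` of the graded algebras `A₁` and `A₂`: these
are mapped into `A` by homomorphisms of graded algebras, and `a₁ ⊗ a₂ ↦ a₁ a₂` is bijective. Thus
`A_γ` is the direct sum of the spaces `(A₁)_γ₁ ⊗ (A₂)_γ₂` with `γ = γ₁ γ₂`. -/
structure IsGradedProduct {Γ K A A₁ A₂ : Type*} [Field K] [Ring A] [Algebra K A]
    [Ring A₁] [Algebra K A₁] [Ring A₂] [Algebra K A₂] (𝒜 : Γ → Submodule K A)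
    (𝒜₁ : Γ → Submodule K A₁) (𝒜₂ : Γ → Submodule K A₂) (j₁ : A₁ →ₐ[K] A) (j₂ : A₂ →ₐ[K] A) :
    Prop where
  map_mem₁ : ∀ γ, ∀ a ∈ 𝒜₁ γ, j₁ a ∈ 𝒜 γ
  map_mem₂ : ∀ γ, ∀ a ∈ 𝒜₂ γ, j₂ a ∈ 𝒜 γ
  bijective : Function.Bijective
    (LinearMap.mul' K A ∘ₗ TensorProduct.map j₁.toLinearMap j₂.toLinearMap)

/-! ### Idempotent ideals -/

section Idempotent

universe u

variable {R : Type u} [Ring R]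

/-- The two-sided ideal `I` of `R` is `k`-idempotent: `Ext^i_R(R/I, Y) = 0` for all `1 ≤ i ≤ k` and
all `R/I`-modules `Y`, that is, all `R`-modules `Y` with `I Y = 0`. -/
def IsKIdempotent (k : ℕ) (I : Ideal R) [I.IsTwoSided] : Prop :=
  ∀ Y : ModuleCat.{u} R, (∀ a ∈ I, ∀ y : Y, a • y = 0) →
    ∀ i : ℕ, 1 ≤ i → i ≤ k →
      Subsingleton (CategoryTheory.Abelian.Ext (ModuleCat.of R (R ⧸ I)) Y i)

/-- The two-sided ideal `I` is strong idempotent. -/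
def IsStrongIdempotent (I : Ideal R) [I.IsTwoSided] : Prop := ∀ k : ℕ, IsKIdempotent k I

/-- `e` is an idempotent and `R e R` is a heredity ideal: `e Rad(R) e = 0`, and `R e R` is
projective as a left `R`-module. -/
def IsHeredityIdeal (e : R) : Prop :=
  IsIdempotentElem e ∧ (∀ a ∈ Ring.jacobson R, e * a * e = 0) ∧ Module.Projective R (idealGen e)

end Idempotent

/-! Write `R = C(X_k)`, `z = z_k`, `e = χ_z`, and let `α_i`, `β_j` be the images in `A` of the bases
`J₁`, `J₂`. The point is that `ReR` factorizes freely: it is the direct sum of the `α_i χ_z U`,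
where `U` is spanned by the `β_j χ_y` with `deg(β_j) y = z`, while `Re` is the sum of the `α_i χ_z
D`, where `D` is spanned by the `β_j χ_z` of degree `0`, and `DU ⊆ U`.

The factorization (`TriangularBasis.isFreeFactorization`) comes from the basis `α_i β_j χ_y` of
`C(Y)`. The two order conditions on the `z_i` are opposite, so that `W = Y \ X_k` is closed under
the `β_j` going forward and under the `α_i` going backward. Hence the kernel of `C(Y) → R` lies in
the span of the basis elements whose middle point `deg(β_j) y` is in `W` (`idealGen_le_midSpan`),
and those with middle point `z` stay independent in `R`.

The rest is ring theory. In the presentation `R^(U) → ReR` every relation `ω` is `ω(1 - e) + ωe`,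
and freeness makes `ωe` a sum of multiples `p_s g_s` of relations `g_s` with coefficients in `D`. A
homomorphism from the relations to a module killed by `ReR` vanishes on each `p_s g_s`, so it
extends to `R^(U)`; this gives `Ext^1(ReR, M) = 0` and 2-idempotence (`isKIdempotent_two`). If `A_0`
is semisimple, the relations over `A_0` have a complement, which splits the presentation and makes
`ReR` projective (`projective_idealGen`). Strong idempotence then follows by removing the points of
`Z` one at a time (`IsStrongIdempotent.comap`). -/

/-! ### Vanishing of `Ext` for modules -/

section ExtVanishing

universe u

open CategoryTheory CategoryTheory.Abelian

variable {R : Type u} [Ring R] {N F L : Type u} [AddCommGroup N] [Module R N]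
  [AddCommGroup F] [Module R F] [AddCommGroup L] [Module R L]

/-- `Ext ^ n (N, M) = 0`. -/
abbrev ExtVanishes (R : Type u) [Ring R] (N : Type u) [AddCommGroup N] [Module R N]
    (M : ModuleCat.{u} R) (n : ℕ) : Prop :=
  Subsingleton (Ext (ModuleCat.of R N) M n)

theorem extVanishes_of_projective [Module.Projective R N] (M : ModuleCat.{u} R) (n : ℕ) :
    ExtVanishes R N M (n + 1) := by
  have : Projective (ModuleCat.of R N) := (IsProjective.iff_projective _).1 ‹_›
  exact Ext.subsingleton_of_projective _ _ _

theorem ExtVanishes.of_retract {M : ModuleCat.{u} R} {n : ℕ} (h : ExtVanishes R F M n)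
    (i : N →ₗ[R] F) (r : F →ₗ[R] N) (hri : r ∘ₗ i = LinearMap.id) : ExtVanishes R N M n := by
  refine subsingleton_of_forall_eq 0 fun x => ?_
  have h1 : (Ext.mk₀ (ModuleCat.ofHom i)).comp
      ((Ext.mk₀ (ModuleCat.ofHom r)).comp x (zero_add n)) (zero_add n) = x := by
    rw [Ext.mk₀_comp_mk₀_assoc, ← ModuleCat.ofHom_comp, hri, ModuleCat.ofHom_id, Ext.mk₀_id_comp]
  rw [← h1, Subsingleton.elim ((Ext.mk₀ (ModuleCat.ofHom r)).comp x (zero_add n)) 0, Ext.comp_zero]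

theorem shortExact_of_exact {f : N →ₗ[R] F} {g : F →ₗ[R] L} (hf : Function.Injective f)
    (hg : Function.Surjective g) (hfg : Function.Exact f g) :
    (ShortComplex.mk (ModuleCat.ofHom f) (ModuleCat.ofHom g)
      (by rw [← ModuleCat.ofHom_comp, hfg.linearMap_comp_eq_zero]; rfl)).ShortExact where
  exact := (ShortComplex.ShortExact.moduleCat_exact_iff_function_exact _).2 hfg
  mono_f := (ModuleCat.mono_iff_injective _).2 hf
  epi_g := (ModuleCat.epi_iff_surjective _).2 hg

section

variable {f : N →ₗ[R] F} {g : F →ₗ[R] L} (hf : Function.Injective f)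
  (hg : Function.Surjective g) (hfg : Function.Exact f g) {M : ModuleCat.{u} R}

include hf hg hfg

theorem ExtVanishes.succ_of_exact {n : ℕ} (hN : ExtVanishes R N M n)
    (hF : ExtVanishes R F M (n + 1)) : ExtVanishes R L M (n + 1) := by
  refine subsingleton_of_forall_eq 0 fun x => ?_
  obtain ⟨y, rfl⟩ := Ext.contravariant_sequence_exact₃ (shortExact_of_exact hf hg hfg) M x
    (hF.elim _ _) (Nat.add_comm 1 n)
  rw [hN.elim y 0, Ext.comp_zero]

/-- The bottom case of dimension shifting: extendability of homomorphisms from `N` replaces a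
vanishing `Ext^0(N, M)`, which would be too strong to ask. -/
theorem extVanishes_one_of_exact (hN : ∀ φ : N →ₗ[R] M, ∃ ψ : F →ₗ[R] M, ψ ∘ₗ f = φ)
    (hF : ExtVanishes R F M 1) : ExtVanishes R L M 1 := by
  refine subsingleton_of_forall_eq 0 fun x => ?_
  obtain ⟨y, rfl⟩ := Ext.contravariant_sequence_exact₃ (shortExact_of_exact hf hg hfg) M x
    (hF.elim _ _) (Nat.add_comm 1 0)
  obtain ⟨φ, rfl⟩ := (Ext.mk₀_bijective _ _).2 y
  obtain ⟨ψ, hψ⟩ := hN φ.hom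
  have h1 : φ = ModuleCat.ofHom f ≫ ModuleCat.ofHom ψ := ModuleCat.hom_ext hψ.symm
  rw [h1, ← Ext.mk₀_comp_mk₀]
  exact (shortExact_of_exact hf hg hfg).extClass_comp_assoc _

theorem ExtVanishes.of_exact {n : ℕ} (hL : ExtVanishes R L M (n + 1))
    (hF : ExtVanishes R F M n) : ExtVanishes R N M n := by
  refine subsingleton_of_forall_eq 0 fun x => ?_
  obtain ⟨y, rfl⟩ := Ext.contravariant_sequence_exact₁ (shortExact_of_exact hf hg hfg) M x
    (Nat.add_comm 1 n) (hL.elim _ _)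
  rw [hF.elim y 0, Ext.comp_zero]

theorem ExtVanishes.exists_extension (hL : ExtVanishes R L M 1) (φ : N →ₗ[R] M) :
    ∃ ψ : F →ₗ[R] M, ψ ∘ₗ f = φ := by
  obtain ⟨y, hy⟩ := Ext.contravariant_sequence_exact₁ (shortExact_of_exact hf hg hfg) M
    (Ext.mk₀ (ModuleCat.ofHom φ)) (Nat.add_comm 1 0) (hL.elim _ _)
  obtain ⟨ψ, rfl⟩ := (Ext.mk₀_bijective _ _).2 y
  rw [Ext.mk₀_comp_mk₀] at hy
  have := (Ext.mk₀_bijective _ _).1 hy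
  exact ⟨ψ.hom, congrArg ModuleCat.Hom.hom this⟩

end

theorem Finsupp.exact_mapRange {f : N →ₗ[R] F} {g : F →ₗ[R] L} (hf : Function.Injective f)
    (hfg : Function.Exact f g) (T : Type*) :
    Function.Exact (Finsupp.mapRange.linearMap (α := T) f)
      (Finsupp.mapRange.linearMap (α := T) g) := by
  intro y
  constructor
  · intro hy
    choose x hx using fun t => (hfg (y t)).1 (by simpa using DFunLike.congr_fun hy t)
    refine ⟨Finsupp.onFinset y.support x fun t ht => ?_, ?_⟩
    · rw [Finsupp.mem_support_iff, ← hx]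
      exact fun h => ht (hf (h.trans (map_zero f).symm))
    · ext t
      simpa using hx t
  · rintro ⟨x, rfl⟩
    ext t
    simpa using hfg.apply_apply_eq_zero (x t)

theorem exists_free_presentation (L : Type u) [AddCommGroup L] [Module R L] :
    ∃ (N F : Type u) (_ : AddCommGroup N) (_ : Module R N) (_ : AddCommGroup F) (_ : Module R F)
      (f : N →ₗ[R] F) (g : F →ₗ[R] L), Module.Free R F ∧ Function.Injective f ∧
      Function.Surjective g ∧ Function.Exact f g :=
  ⟨_, _, _, _, _, _, _, Finsupp.linearCombination R (id : L → L), inferInstance,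
    Subtype.val_injective, Finsupp.linearCombination_id_surjective R L,
    LinearMap.exact_subtype_ker_map _⟩

/-- `Ext` vanishes on direct sums of copies of a module on which it vanishes. -/
theorem ExtVanishes.finsupp {M : ModuleCat.{u} R} (T : Type u) {n : ℕ} :
    ∀ {L : Type u} [AddCommGroup L] [Module R L], ExtVanishes R L M (n + 1) →
      ExtVanishes R (T →₀ L) M (n + 1) := by
  induction n with
  -- Homomorphisms from a direct sum of copies of `N` are extended on each copy separately.
  | zero =>
    intro L _ _ h
    obtain ⟨N, F, _, _, _, _, f, g, _, hf, hg, hfg⟩ := exists_free_presentation (R := R) L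
    refine extVanishes_one_of_exact (f := Finsupp.mapRange.linearMap f)
      (g := Finsupp.mapRange.linearMap g) (Finsupp.mapRange_injective _ (map_zero f) hf)
      (Finsupp.mapRange_surjective _ (map_zero g) hg)
      (Finsupp.exact_mapRange hf hfg T) (fun φ => ?_) (extVanishes_of_projective M 0)
    choose ψ hψ using fun t : T => h.exists_extension hf hg hfg (φ ∘ₗ Finsupp.lsingle t)
    refine ⟨Finsupp.lsum ℕ ψ, ?_⟩
    ext t x
    simpa using LinearMap.congr_fun (hψ t) x
  -- Dimension shifting down to the syzygy `N` and, after taking direct sums, up again.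
  | succ n ih =>
    intro L _ _ h
    obtain ⟨N, F, _, _, _, _, f, g, _, hf, hg, hfg⟩ := exists_free_presentation (R := R) L
    exact (ih (h.of_exact hf hg hfg (extVanishes_of_projective M n))).succ_of_exact
      (f := Finsupp.mapRange.linearMap f) (g := Finsupp.mapRange.linearMap g)
      (Finsupp.mapRange_injective _ (map_zero f) hf) (Finsupp.mapRange_surjective _ (map_zero g) hg)
      (Finsupp.exact_mapRange hf hfg T) (extVanishes_of_projective M _)

end ExtVanishing

/-! ### The ideal generated by an idempotent -/

section IdealGen

variable {R : Type*} [Ring R] {e : R}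

theorem mul_mul_mem_idealGen (r r' : R) : r * e * r' ∈ idealGen e :=
  Ideal.mul_mem_mul (Ideal.mul_mem_left _ _ (Ideal.mem_span_singleton_self e)) trivial

theorem mem_idealGen_self (e : R) : e ∈ idealGen e := by
  simpa using mul_mul_mem_idealGen (e := e) 1 1

theorem mul_mem_idealGen (r : R) : e * r ∈ idealGen e := by
  simpa using mul_mul_mem_idealGen (e := e) 1 r

theorem idealGen_induction {P : R → Prop} (add : ∀ x y, P x → P y → P (x + y))
    (mul : ∀ r r', P (r * e * r')) {x : R} (hx : x ∈ idealGen e) : P x := by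
  refine Submodule.smul_induction_on hx (fun a ha b _ => ?_) add
  obtain ⟨r, rfl⟩ := Ideal.mem_span_singleton'.1 ha
  exact mul r b

theorem idealGen_le {I : Ideal R} [I.IsTwoSided] (he : e ∈ I) : idealGen e ≤ I := fun _ hx =>
  idealGen_induction (fun _ _ => I.add_mem)
    (fun r r' => I.mul_mem_right r' (I.mul_mem_left r he)) hx

end IdealGen

section AbstractIdeals

universe u

open CategoryTheory CategoryTheory.Abelian

variable {R : Type u} [Ring R] {e : R}

/-- `Ext ^ 1 (R / I, M) = 0` if there are no homomorphisms from `I` to `M`. -/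
theorem extVanishes_quotient_one {I : Ideal R} {M : ModuleCat.{u} R}
    (h : ∀ φ : I →ₗ[R] M, φ = 0) : ExtVanishes R (R ⧸ I) M 1 :=
  extVanishes_one_of_exact (f := I.subtype) (g := Submodule.mkQ I) Subtype.val_injective
    (Submodule.mkQ_surjective I) (LinearMap.exact_subtype_mkQ I) (fun φ => ⟨0, by simp [h φ]⟩)
    (extVanishes_of_projective M 0)

theorem ExtVanishes.quotient_succ {I : Ideal R} {M : ModuleCat.{u} R} {n : ℕ}
    (h : ExtVanishes R I M n) : ExtVanishes R (R ⧸ I) M (n + 1) :=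
  h.succ_of_exact (f := I.subtype) (g := Submodule.mkQ I) Subtype.val_injective
    (Submodule.mkQ_surjective I) (LinearMap.exact_subtype_mkQ I) (extVanishes_of_projective M n)

/-- Only additivity is assumed, so that it also serves for maps that are linear over a ring mapping
to `R`. -/
theorem addMonoidHom_idealGen_eq_zero {M F : Type*} [AddCommGroup M] [FunLike F (idealGen e) M]
    [AddMonoidHomClass F (idealGen e) M] (φ : F)
    (h : ∀ r r', φ ⟨r * e * r', mul_mul_mem_idealGen r r'⟩ = 0) (x : idealGen e) : φ x = 0 := by
  obtain ⟨x, hx⟩ := x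
  suffices ∃ hx : x ∈ idealGen e, φ ⟨x, hx⟩ = 0 from this.2
  refine idealGen_induction (P := fun x => ∃ hx : x ∈ idealGen e, φ ⟨x, hx⟩ = 0)
    (fun x y => ?_) (fun r r' => ⟨_, h r r'⟩) hx
  rintro ⟨hx, h₁⟩ ⟨hy, h₂⟩
  exact ⟨add_mem hx hy, (map_add φ ⟨x, hx⟩ ⟨y, hy⟩).trans (by rw [h₁, h₂, add_zero])⟩

/-- Since `r e r' = (r e) (e r')`, the ideal is its own square, and a homomorphism carries it into
`ReR · M = 0`. -/
theorem hom_idealGen_eq_zero (he : IsIdempotentElem e) {M : Type*} [AddCommGroup M] [Module R M]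
    (hM : ∀ a ∈ idealGen e, ∀ y : M, a • y = 0) (φ : idealGen e →ₗ[R] M) : φ = 0 := by
  refine LinearMap.ext (addMonoidHom_idealGen_eq_zero φ fun r r' => ?_)
  have h : (⟨r * e * r', mul_mul_mem_idealGen r r'⟩ : idealGen e) =
      (r * e) • ⟨e * r', mul_mem_idealGen r'⟩ := by
    ext
    simp [← mul_assoc, mul_assoc r e e, he.eq]
  rw [h, map_smul]
  exact hM _ (by simpa using mul_mul_mem_idealGen r 1) _

theorem isStrongIdempotent_bot : IsStrongIdempotent (⊥ : Ideal R) := by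
  intro k Y _ i hi _
  obtain ⟨n, rfl⟩ := Nat.exists_eq_add_of_le' hi
  have : Module.Projective R (R ⧸ (⊥ : Ideal R)) :=
    Module.Projective.of_equiv (Submodule.quotEquivOfEqBot (⊥ : Ideal R) rfl).symm
  exact extVanishes_of_projective Y n

/-- Strong idempotence is inherited along a surjective ring homomorphism with strong idempotent
kernel by the preimage of a projective ideal generated by an idempotent. -/
theorem IsStrongIdempotent.comap {R' : Type u} [Ring R'] (f : R →+* R')
    (hf : Function.Surjective f) {I J : Ideal R} [I.IsTwoSided] [J.IsTwoSided]
    (hJ : IsStrongIdempotent J) (hJf : ∀ r, r ∈ J ↔ f r = 0) {e : R'} (he : IsIdempotentElem e)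
    [Module.Projective R' (idealGen e)] (hIf : ∀ r, r ∈ I ↔ f r ∈ idealGen e) :
    IsStrongIdempotent I := by
  intro k Y hY i hi _
  let : Module R R' := Module.compHom R' f
  have hsmul (r : R) (x : R') : r • x = f r * x := rfl
  have : IsScalarTower R R' R' := ⟨fun r x y => mul_assoc (f r) x y⟩
  -- As an `R`-module `R'` is `R/J`, and `J ⊆ I` kills `Y`.
  have hR' (n : ℕ) : ExtVanishes R R' Y (n + 1) := by
    have hker : J = LinearMap.ker (LinearMap.toSpanSingleton R R' 1) := by
      ext r
      simp [hJf, hsmul]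
    have h := hJ (n + 1) Y (fun a ha => hY a ((hIf a).2 (by rw [(hJf a).1 ha]; exact zero_mem _)))
      (n + 1) n.succ_pos le_rfl
    let E : (R ⧸ J) ≃ₗ[R] R' := (Submodule.quotEquivOfEq _ _ hker).trans
      (LinearMap.quotKerEquivOfSurjective _ fun x => by
        obtain ⟨r, rfl⟩ := hf x
        exact ⟨r, by simp [hsmul]⟩)
    exact ExtVanishes.of_retract (F := R ⧸ J) h E.symm.toLinearMap E.toLinearMap (by ext; simp)
  -- A projective `R'`-module is a retract of a direct sum of copies of `R'`.
  have hP (n : ℕ) : ExtVanishes R (idealGen e) Y (n + 1) := by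
    obtain ⟨s, hs⟩ := Module.projective_def'.1 (inferInstance : Module.Projective R' (idealGen e))
    exact ExtVanishes.of_retract ((hR' n).finsupp (idealGen e)) (s.restrictScalars R)
      ((Finsupp.linearCombination R' id).restrictScalars R)
      (by ext x; exact congrArg Subtype.val (LinearMap.congr_fun hs x))
  have h0 (φ : idealGen e →ₗ[R] Y) : φ = 0 := by
    refine LinearMap.ext (addMonoidHom_idealGen_eq_zero φ fun r r' => ?_)
    obtain ⟨s, hs⟩ := hf (r * e)
    have h : (⟨r * e * r', mul_mul_mem_idealGen r r'⟩ : idealGen e) =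
        s • ⟨e * r', mul_mem_idealGen r'⟩ := by
      ext
      simp [hsmul, hs, ← mul_assoc, mul_assoc r e e, he.eq]
    rw [h, map_smul]
    exact hY s ((hIf s).2 (by rw [hs]; simpa using mul_mul_mem_idealGen r 1)) _
  -- `R/I` is `R'/R'eR'`, so the remaining vanishing is read off from `0 → R'eR' → R' → R/I → 0`.
  let N : Submodule R R' := (idealGen e).restrictScalars R
  have hI : I = LinearMap.ker (N.mkQ ∘ₗ LinearMap.toSpanSingleton R R' 1) := by
    ext r
    simp [hIf, hsmul, N]
  let E : (R ⧸ I) ≃ₗ[R] (R' ⧸ N) := (Submodule.quotEquivOfEq _ _ hI).trans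
    (LinearMap.quotKerEquivOfSurjective _ fun x => by
      obtain ⟨x, rfl⟩ := N.mkQ_surjective x
      obtain ⟨r, rfl⟩ := hf x
      exact ⟨r, by simp [hsmul]⟩)
  suffices ExtVanishes R (R' ⧸ N) Y i from
    ExtVanishes.of_retract (F := R' ⧸ N) this E.toLinearMap E.symm.toLinearMap
      (LinearMap.ext fun x => E.symm_apply_apply x)
  obtain ⟨n, rfl⟩ := Nat.exists_eq_add_of_le' hi
  cases n with
  | zero =>
    exact extVanishes_one_of_exact (f := N.subtype) (g := N.mkQ) Subtype.val_injective
      N.mkQ_surjective (LinearMap.exact_subtype_mkQ N) (fun φ => ⟨0, (h0 φ).symm⟩) (hR' 0)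
  | succ n =>
    exact (hP n).succ_of_exact (f := N.subtype) (g := N.mkQ) Subtype.val_injective
      N.mkQ_surjective (LinearMap.exact_subtype_mkQ N) (hR' _)

end AbstractIdeals

/-! ### Ideals with a free factorization -/

/-- The ideal `R e R` factorizes as `⨁ p_s U` with `U ⊆ e R`, and `R e` is the sum of the `p_s D`
for an additive group `D` that stabilizes `U`. -/
structure IsFreeFactorization {R σ : Type*} [Ring R] (e : R) (p : σ → R) (D U : AddSubgroup R) :
    Prop where
  mul_idem : ∀ s, p s * e = p s
  idem_mul : ∀ x ∈ U, e * x = x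
  mul_mem : ∀ d ∈ D, ∀ x ∈ U, d * x ∈ U
  exists_sum : ∀ r, ∃ f : σ →₀ R, (∀ s, f s ∈ D) ∧ r * e = f.sum fun s d => p s * d
  mem_span : ∀ r, e * r ∈ Ideal.span (U : Set R)
  free : ∀ f : σ →₀ R, (∀ s, f s ∈ U) → (f.sum fun s x => p s * x) = 0 → f = 0

namespace IsFreeFactorization

universe u

open CategoryTheory CategoryTheory.Abelian

section

variable {R σ : Type*} [Ring R] {e : R} {p : σ → R} {D U : AddSubgroup R}
  (h : IsFreeFactorization e p D U)

include h

theorem mem_idealGen {x : R} (hx : x ∈ U) : x ∈ idealGen e := by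
  rw [← h.idem_mul x hx]
  exact mul_mem_idealGen x

theorem mem_idealGen_left (s : σ) : p s ∈ idealGen e := by
  rw [← h.mul_idem s]
  simpa using mul_mul_mem_idealGen (e := e) (p s) 1

theorem range_linearCombination :
    (Finsupp.linearCombination R (Subtype.val : U → R)).range = idealGen e := by
  rw [Finsupp.range_linearCombination, Subtype.range_coe_subtype]
  refine le_antisymm (Submodule.span_le.2 fun x hx => h.mem_idealGen hx) fun x hx => ?_
  refine idealGen_induction (P := fun x => x ∈ Ideal.span (U : Set R)) (fun _ _ => add_mem)
    (fun r r' => ?_) hx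
  rw [mul_assoc]
  exact Ideal.mul_mem_left _ _ (h.mem_span r')

/-- Expanding each coefficient of `ωe` along `Re = ∑ p_s D` gives the `g_s`. As `e` fixes `U`, `ωe`
is again a relation, so `∑ p_s y_s = 0` for the values `y_s` of the `g_s`; these lie in `DU ⊆ U`,
and freeness makes each of them zero. -/
theorem exists_decomposition (ω : U →₀ R)
    (hω : Finsupp.linearCombination R (Subtype.val : U → R) ω = 0) :
    ∃ g : σ →₀ U →₀ R, (∀ s x, g s x ∈ D) ∧
      (∀ s, Finsupp.linearCombination R (Subtype.val : U → R) (g s) = 0) ∧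
      ω.mapRange (· * e) (zero_mul e) = g.sum fun s w => p s • w := by
  choose f hfD hf using fun x => h.exists_sum (ω x)
  let g : σ →₀ U →₀ R := ∑ x ∈ ω.support, (f x).mapRange (Finsupp.single x) (Finsupp.single_zero x)
  have hgD (s x) : g s x ∈ D := by
    simp only [g, Finsupp.finsetSum_apply, Finsupp.mapRange_apply]
    refine sum_mem fun y _ => ?_
    classical
    rw [Finsupp.single_apply]
    split_ifs
    exacts [hfD _ _, zero_mem D]
  have hg : ω.mapRange (· * e) (zero_mul e) = g.sum fun s w => p s • w := by
    rw [← Finsupp.sum_finsetSum_index (h := fun s w => p s • w) (fun _ => smul_zero _)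
      fun _ => smul_add _]
    rw [← Finsupp.sum_single (ω.mapRange (· * e) (zero_mul e)),
      Finsupp.sum_mapRange_index (by simp)]
    refine Finset.sum_congr rfl fun x _ => ?_
    rw [Finsupp.sum_mapRange_index (by simp)]
    simp only [hf, Finsupp.smul_single, smul_eq_mul, Finsupp.single_sum]
  refine ⟨g, hgD, fun s => ?_, hg⟩
  let y : σ →₀ R := g.mapRange (Finsupp.linearCombination R (Subtype.val : U → R)) (map_zero _)
  suffices hy : y = 0 by simpa [y] using DFunLike.congr_fun hy s
  refine h.free y (fun s => ?_) ?_
  · simp only [y, Finsupp.mapRange_apply, Finsupp.linearCombination_apply]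
    exact sum_mem fun x _ => h.mul_mem _ (hgD s x) _ x.2
  · rw [Finsupp.sum_mapRange_index (by simp)]
    have := congrArg (Finsupp.linearCombination R (Subtype.val : U → R)) hg
    rw [map_finsuppSum] at this
    simp only [map_smul, smul_eq_mul] at this
    rw [← this, ← hω, Finsupp.linearCombination_apply, Finsupp.linearCombination_apply,
      Finsupp.sum_mapRange_index (by simp)]
    simp only [smul_eq_mul, mul_assoc, h.idem_mul _ (Subtype.prop _)]

end

section

variable {R : Type u} [Ring R] {σ : Type*} {e : R} {p : σ → R} {D U : AddSubgroup R}
  (h : IsFreeFactorization e p D U)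

include h

theorem isKIdempotent_two (he : IsIdempotentElem e) : IsKIdempotent 2 (idealGen e) := by
  intro Y hY i hi hi2
  obtain rfl | rfl : i = 1 ∨ i = 2 := by omega
  · exact extVanishes_quotient_one (hom_idealGen_eq_zero he hY)
  · refine ExtVanishes.quotient_succ ?_
    let Φ := Finsupp.linearCombination R (Subtype.val : U → R)
    rw [← h.range_linearCombination]
    have hex : Function.Exact Φ.ker.subtype Φ.rangeRestrict := by
      rw [LinearMap.exact_iff, LinearMap.ker_rangeRestrict, Submodule.range_subtype]
    refine extVanishes_one_of_exact (R := R) (N := Φ.ker) (F := U →₀ R) (L := Φ.range)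
      Φ.ker.injective_subtype Φ.surjective_rangeRestrict hex (fun φ => ?_)
      (extVanishes_of_projective Y 0)
    -- Here `p_s = p_s e` lies in `ReR`, which annihilates `Y`.
    have hφ (w : Φ.ker) (s : σ) : φ (p s • w) = 0 := by
      rw [map_smul]
      exact hY _ (h.mem_idealGen_left s) _
    have hmem (x : U) : Finsupp.single x (1 - e) ∈ Φ.ker := by
      simp [Φ, h.idem_mul x x.2]
    -- The extension is forced on the part `ω(1 - e)` and is zero on the part `ωe`.
    refine ⟨Finsupp.linearCombination R fun x => φ ⟨_, hmem x⟩, LinearMap.ext fun ⟨ω, hω⟩ => ?_⟩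
    obtain ⟨g, hgD, hg, hgω⟩ := h.exists_decomposition ω hω
    have hω' : (⟨ω, hω⟩ : Φ.ker) = (ω.sum fun x r => r • ⟨_, hmem x⟩) +
        g.sum fun s _ => p s • ⟨g s, hg s⟩ := by
      refine Subtype.ext ?_
      rw [Submodule.coe_add, Finsupp.sum, Finsupp.sum, Submodule.coe_sum, Submodule.coe_sum]
      simp only [SetLike.val_smul]
      change ω = _ + g.sum fun s w => p s • w
      rw [← hgω]
      clear * -
      change ω = (ω.sum fun x r => r • Finsupp.single x (1 - e)) + _
      induction ω using Finsupp.induction_linear with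
      | zero => simp
      | add v w hv hw =>
        rw [Finsupp.sum_add_index' (by simp) (by simp [add_smul]),
          Finsupp.mapRange_add (fun _ _ => add_mul _ _ _), add_add_add_comm, ← hv, ← hw]
      | single x r =>
        rw [Finsupp.sum_single_index (by simp), Finsupp.mapRange_single, Finsupp.smul_single,
          ← Finsupp.single_add]
        simp [mul_sub]
    rw [LinearMap.comp_apply, Submodule.subtype_apply, Finsupp.linearCombination_apply]
    conv_rhs => rw [hω', map_add, map_finsuppSum, map_finsuppSum]
    simp only [hφ, map_smul]
    simp [Finsupp.sum]

/-- The splitting is found over `B`: subtracting from each generator its projection to the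
`B`-relations gives a map `ρ` over `R` that kills all relations and does not change the value under
`Φ`, hence a section of `Φ`. Killing the relations with coefficients in `D` is enough, by
`exists_decomposition`. -/
theorem projective_idealGen {B : Type*} [Ring B] [IsSemisimpleRing B] (φ : B →ₙ+* R)
    (hφ : φ 1 = e) (hD : ∀ d ∈ D, ∃ b, φ b = d) : Module.Projective R (idealGen e) := by
  let Φ := Finsupp.linearCombination R (Subtype.val : U → R)
  let m : (U →₀ B) →+ (U →₀ R) := Finsupp.mapRange.addMonoidHom (φ : B →+ R)
  have hm_apply (w : U →₀ B) (x : U) : m w x = φ (w x) := rfl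
  have hm_single (x : U) (b : B) : m (Finsupp.single x b) = Finsupp.single x (φ b) :=
    Finsupp.mapRange_single (hf := map_zero φ)
  have hm_smul (b : B) (w : U →₀ B) : m (b • w) = φ b • m w := by
    ext x
    simp [hm_apply]
  have he_m (w : U →₀ B) : e • m w = m w := by rw [← hφ, ← hm_smul, one_smul]
  -- the kernel of the corresponding map of free `B`-modules has a complement
  let N : Submodule B (U →₀ B) :=
    { (Φ.toAddMonoidHom.comp m).ker with
      smul_mem' := fun b w (hw : Φ (m w) = 0) => show Φ (m (b • w)) = 0 by
        rw [hm_smul, map_smul, hw, smul_zero] }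
  obtain ⟨N', hN'⟩ := exists_isCompl N
  let π : (U →₀ B) →ₗ[B] (U →₀ B) := N.subtype ∘ₗ N.projectionOnto N' hN'
  have hπN (w) : Φ (m (π w)) = 0 := (N.projectionOnto N' hN' w).2
  have hπ (w) (hw : Φ (m w) = 0) : π w = w :=
    congrArg Subtype.val (N.projectionOnto_apply_left hN' (⟨w, hw⟩ : N))
  let ρ : (U →₀ R) →ₗ[R] (U →₀ R) :=
    Finsupp.linearCombination R fun x => m (Finsupp.single x 1 - π (Finsupp.single x 1))
  have hΦρ : Φ ∘ₗ ρ = Φ := by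
    refine Finsupp.lhom_ext' fun x => LinearMap.ext_ring ?_
    simp [ρ, Φ, hφ, hm_single, h.idem_mul x x.2, hπN]
  have hρm (w) : ρ (m w) = m (w - π w) := by
    induction w using Finsupp.induction_linear with
    | zero => simp
    | add v w hv hw => simp only [map_add, hv, hw, map_sub]; abel
    | single x b =>
      rw [hm_single, Finsupp.linearCombination_single, ← hm_smul, smul_sub, ← map_smul,
        Finsupp.smul_single, smul_eq_mul, mul_one]
  have hρe (w : U →₀ R) : ρ (w.mapRange (· * e) (zero_mul e)) = ρ w := by
    simp only [ρ, Finsupp.linearCombination_apply]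
    rw [Finsupp.sum_mapRange_index (by simp)]
    simp only [mul_smul, he_m]
  have hker : Φ.ker ≤ ρ.ker := fun w hw => by
    obtain ⟨g, hgD, hg, hgw⟩ := h.exists_decomposition w hw
    rw [LinearMap.mem_ker, ← hρe, hgw, map_finsuppSum]
    refine Finset.sum_eq_zero fun s _ => ?_
    -- The preimage of a zero coefficient is chosen to be zero, so that the lift to `B` has finite
    -- support.
    have hD' (x : U) : ∃ b, φ b = g s x ∧ (b ≠ 0 → g s x ≠ 0) := by
      by_cases hx : g s x = 0
      · exact ⟨0, by rw [map_zero, hx], fun h0 => absurd rfl h0⟩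
      · obtain ⟨b, hb⟩ := hD _ (hgD s x)
        exact ⟨b, hb, fun _ => hx⟩
    choose b hb hb0 using hD'
    have hgs : m (Finsupp.onFinset (g s).support b fun x hx =>
        Finsupp.mem_support_iff.2 (hb0 x hx)) = g s := by
      ext x
      simp [hm_apply, hb]
    change ρ (p s • g s) = 0
    rw [map_smul, ← hgs, hρm, hπ, sub_self, map_zero, smul_zero]
    rw [hgs, hg]
  rw [← h.range_linearCombination]
  refine Module.Projective.of_split (Φ.ker.liftQ ρ hker ∘ₗ Φ.quotKerEquivRange.symm.toLinearMap)
    Φ.rangeRestrict (LinearMap.ext fun x => ?_)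
  obtain ⟨x, hx⟩ := x
  obtain ⟨w, rfl⟩ := hx
  have hw : Φ.quotKerEquivRange.symm ⟨Φ w, ⟨w, rfl⟩⟩ = Φ.ker.mkQ w := by
    rw [LinearEquiv.symm_apply_eq]
    rfl
  refine Subtype.ext ?_
  change Φ (Φ.ker.liftQ ρ hker (Φ.quotKerEquivRange.symm ⟨Φ w, ⟨w, rfl⟩⟩)) = Φ w
  rw [hw]
  exact LinearMap.congr_fun hΦρ w

end

end IsFreeFactorization

/-! ### Calculation in the algebras `C(X)` -/

section SkewMap

variable {Γ K A A' : Type*} [DecidableEq Γ] [AddMonoid Γ] [Field K] [Ring A] [Algebra K A]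
  [Ring A'] [Algebra K A'] (𝒜 : Γ → Submodule K A) [GradedAlgebra 𝒜] (𝒜' : Γ → Submodule K A')
  [GradedAlgebra 𝒜'] (S : Type*) [AddAction Γ S]

theorem SkewProduct.induction {B : Type*} [Ring B] [Algebra K B] {ρ : GammaAlgebra Γ K B}
    {P : SkewProduct 𝒜 ρ → Prop} (zero : P 0) (add : ∀ x y, P x → P y → P (x + y))
    (tmul : ∀ γ, ∀ a ∈ 𝒜 γ, ∀ b, P (SkewProduct.tmul 𝒜 ρ a b)) (x : SkewProduct 𝒜 ρ) : P x :=
  skew_induction 𝒜 zero add tmul x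

/-- The linear map of skew products induced by a linear map. -/
noncomputable def SkewC.mapₗ (j : A' →ₗ[K] A) : SkewC 𝒜' S →ₗ[K] SkewC 𝒜 S :=
  (TensorProduct.map j LinearMap.id : A' ⊗[K] (S → K) →ₗ[K] A ⊗[K] (S → K))

theorem SkewC.mapₗ_tmul (j : A' →ₗ[K] A) (a : A') (b : S → K) :
    SkewC.mapₗ 𝒜 𝒜' S j (SkewProduct.tmul 𝒜' _ a b) = SkewProduct.tmul 𝒜 _ (j a) b := rfl

/-- The homomorphism of skew products induced by a homomorphism of graded algebras. -/
noncomputable def SkewC.map (j : A' →ₐ[K] A) (hj : ∀ γ, ∀ a ∈ 𝒜' γ, j a ∈ 𝒜 γ) :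
    SkewC 𝒜' S →ₐ[K] SkewC 𝒜 S :=
  AlgHom.ofLinearMap (SkewC.mapₗ 𝒜 𝒜' S j.toLinearMap)
    (congrArg (· ⊗ₜ[K] (1 : S → K)) (map_one j)) (by
      intro x y
      induction x using SkewProduct.induction 𝒜' with
      | zero => rw [zero_mul, map_zero, zero_mul]
      | add x x' hx hx' => rw [add_mul, map_add, map_add, hx, hx', add_mul]
      | tmul γ a ha b =>
        induction y using SkewProduct.induction 𝒜' with
        | zero => rw [mul_zero, map_zero, mul_zero]
        | add y y' hy hy' => rw [mul_add, map_add, map_add, hy, hy', mul_add]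
        | tmul γ' a' ha' b' =>
          rw [SkewProduct.tmul_mul_tmul 𝒜' _ a b ha' b', SkewC.mapₗ_tmul, SkewC.mapₗ_tmul,
            SkewC.mapₗ_tmul]
          refine Eq.trans ?_ (SkewProduct.tmul_mul_tmul 𝒜 _ (j a) b (hj _ _ ha') b').symm
          exact congrArg (SkewProduct.tmul 𝒜 _ · _) (map_mul j a a'))

theorem SkewC.map_tmulChi (j : A' →ₐ[K] A) (hj : ∀ γ, ∀ a ∈ 𝒜' γ, j a ∈ 𝒜 γ) (a : A')
    (T : Set S) : SkewC.map 𝒜 𝒜' S j hj (tmulChi 𝒜' a T) = tmulChi 𝒜 (j a) T := rfl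

end SkewMap

theorem map_mem_idealGen {R R' : Type*} [Ring R] [Ring R'] (f : R →+* R') {e x : R}
    (hx : x ∈ idealGen e) : f x ∈ idealGen (f e) := by
  refine idealGen_induction (P := fun x => f x ∈ idealGen (f e)) (fun x y hx hy => ?_)
    (fun r r' => ?_) hx
  · rw [map_add]
    exact add_mem hx hy
  · rw [map_mul, map_mul]
    exact mul_mul_mem_idealGen _ _

section ChiCalculus

variable {Γ K A : Type*} [DecidableEq Γ] [AddMonoid Γ] [Field K] [Ring A] [Algebra K A]
  (𝒜 : Γ → Submodule K A) [GradedAlgebra 𝒜] {S : Type*} [AddAction Γ S]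

theorem tmulChi_mul_tmulChi {γ : Γ} (a : A) (T : Set S) {a' : A} (ha' : a' ∈ 𝒜 γ) (T' : Set S) :
    tmulChi 𝒜 a T * tmulChi 𝒜 a' T' = tmulChi 𝒜 (a * a') ((γ +ᵥ ·) ⁻¹' T ∩ T') := by
  rw [tmulChi, tmulChi, SkewProduct.tmul_mul_tmul 𝒜 _ a _ ha', tmulChi]
  congr 1
  ext x
  rw [Pi.mul_apply, mapsGammaAlgebra_act_apply, Set.inter_indicator_one]
  rfl

theorem tmulChi_union (a : A) {T T' : Set S} (h : Disjoint T T') :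
    tmulChi 𝒜 a (T ∪ T') = tmulChi 𝒜 a T + tmulChi 𝒜 a T' := by
  rw [tmulChi, Set.indicator_union_of_disjoint h]
  exact TensorProduct.tmul_add a _ _

namespace CAlg

/-- `a ↦ a χ_T` as a linear map. -/
noncomputable def chiₗ (X T : Set S) : A →ₗ[K] CAlg 𝒜 X where
  toFun a := chi 𝒜 X a T
  map_add' a b := congrArg (Ideal.Quotient.mk _) (TensorProduct.add_tmul a b _)
  map_smul' _ _ := rfl

variable {𝒜} {X Y : Set S}

theorem chi_mul_chi {γ : Γ} (a : A) (T : Set S) {a' : A} (ha' : a' ∈ 𝒜 γ) (T' : Set S) :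
    chi 𝒜 X a T * chi 𝒜 X a' T' = chi 𝒜 X (a * a') ((γ +ᵥ ·) ⁻¹' T ∩ T') :=
  congrArg (Ideal.Quotient.mk _) (tmulChi_mul_tmulChi 𝒜 a T ha' T')

theorem chi_empty (a : A) : chi 𝒜 X a ∅ = 0 := by
  refine congrArg (Ideal.Quotient.mk _) (a₂ := 0) ?_
  unfold tmulChi
  rw [Set.indicator_empty]
  exact TensorProduct.tmul_zero _ a

theorem chi_mul_chi_singleton {γ : Γ} (a : A) {T : Set S} {a' : A} (ha' : a' ∈ 𝒜 γ) {y : S}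
    (hy : γ +ᵥ y ∈ T) : chi 𝒜 X a T * chi 𝒜 X a' {y} = chi 𝒜 X (a * a') {y} := by
  rw [chi_mul_chi a T ha', Set.inter_eq_right.2 (by simpa using hy)]

theorem chi_mul_chi_singleton_eq_zero {γ : Γ} (a : A) {T : Set S} {a' : A} (ha' : a' ∈ 𝒜 γ)
    {y : S} (hy : γ +ᵥ y ∉ T) : chi 𝒜 X a T * chi 𝒜 X a' {y} = 0 := by
  rw [chi_mul_chi a T ha', Set.inter_singleton_eq_empty.2 (by simpa using hy), chi_empty]

theorem chi_mul_chi_one (a : A) (T T' : Set S) :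
    chi 𝒜 X a T * chi 𝒜 X 1 T' = chi 𝒜 X a (T ∩ T') := by
  rw [chi_mul_chi a T (SetLike.GradedOne.one_mem (A := 𝒜))]
  simp

theorem isIdempotentElem_chi (T : Set S) : IsIdempotentElem (chi 𝒜 X 1 T) := by
  rw [IsIdempotentElem, chi_mul_chi_one, Set.inter_self]

theorem chi_mul_self (a : A) (T : Set S) : chi 𝒜 X a T * chi 𝒜 X 1 T = chi 𝒜 X a T := by
  rw [chi_mul_chi_one, Set.inter_self]

theorem chi_mul_singleton_of_ne (a : A) {y w : S} (h : y ≠ w) :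
    chi 𝒜 X a {y} * chi 𝒜 X 1 {w} = 0 := by
  rw [chi_mul_chi_one, Set.singleton_inter_eq_empty.2 (by simpa using h), chi_empty]

theorem chi_one_compl : chi 𝒜 X 1 Xᶜ = 0 :=
  Ideal.Quotient.eq_zero_iff_mem.2 (mem_idealGen_self _)

theorem chi_eq_zero (a : A) {T : Set S} (h : Disjoint T X) : chi 𝒜 X a T = 0 := by
  rw [← Set.inter_eq_left.2 h.subset_compl_right, ← chi_mul_chi_one, chi_one_compl, mul_zero]

theorem chi_singleton_eq_zero {γ : Γ} {a : A} (ha : a ∈ 𝒜 γ) {y : S} (hy : γ +ᵥ y ∉ X) :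
    chi 𝒜 X a {y} = 0 := by
  rw [← one_mul a, ← chi_mul_chi_singleton (X := X) (T := Xᶜ) 1 ha hy, chi_one_compl, zero_mul]

theorem chi_one_compl_eq (hXY : X ⊆ Y) : chi 𝒜 Y 1 Xᶜ = chi 𝒜 Y 1 (Y \ X) := by
  have h : Xᶜ = (Y \ X) ∪ Yᶜ := by
    ext x
    by_cases hx : x ∈ Y <;> simp [hx]
    exact fun h => hx (hXY h)
  have hd : Disjoint (Y \ X) Yᶜ := disjoint_compl_right.mono_left Set.sdiff_subset 
  rw [h, chi, tmulChi_union 𝒜 1 hd, map_add]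
  exact (congrArg _ chi_one_compl).trans (add_zero _)

variable (𝒜) in
/-- The projection `C(Y) → C(X)` for `X ⊆ Y`. -/
noncomputable def proj (hXY : X ⊆ Y) : CAlg 𝒜 Y →+* CAlg 𝒜 X :=
  Ideal.Quotient.lift _ (Ideal.Quotient.mk _) fun c hc => by
    have h := map_mem_idealGen (Ideal.Quotient.mk (idealGen (tmulChi 𝒜 1 Xᶜ))) hc
    have h0 : Ideal.Quotient.mk (idealGen (tmulChi 𝒜 1 Xᶜ)) (tmulChi 𝒜 1 Yᶜ) = 0 :=
      chi_eq_zero (X := X) 1 (disjoint_compl_left.mono_right hXY)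
    rw [h0] at h
    exact idealGen_induction (P := fun x => x = 0) (fun x y hx hy => by rw [hx, hy, add_zero])
      (by simp) h

theorem proj_chi (hXY : X ⊆ Y) (a : A) (T : Set S) :
    proj 𝒜 hXY (chi 𝒜 Y a T) = chi 𝒜 X a T := rfl

theorem proj_smul (hXY : X ⊆ Y) (c : K) (x : CAlg 𝒜 Y) :
    proj 𝒜 hXY (c • x) = c • proj 𝒜 hXY x := by
  obtain ⟨x, rfl⟩ := Ideal.Quotient.mk_surjective x
  rfl

theorem proj_surjective (hXY : X ⊆ Y) : Function.Surjective (proj 𝒜 hXY) := fun x => by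
  obtain ⟨x, rfl⟩ := Ideal.Quotient.mk_surjective x
  exact ⟨Ideal.Quotient.mk _ x, rfl⟩

/-- In `C(Y)` the functions `χ_{S \ X}` and `χ_{Y \ X}` coincide, because `χ_{S \ Y}` vanishes
there. -/
theorem proj_eq_zero_iff (hXY : X ⊆ Y) (x : CAlg 𝒜 Y) :
    proj 𝒜 hXY x = 0 ↔ x ∈ idealGen (chi 𝒜 Y 1 (Y \ X)) := by
  constructor
  · obtain ⟨x, rfl⟩ := Ideal.Quotient.mk_surjective x
    intro h
    rw [← chi_one_compl_eq hXY]
    exact map_mem_idealGen (Ideal.Quotient.mk _) (Ideal.Quotient.eq_zero_iff_mem.1 h)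
  · intro h
    have : (RingHom.ker (proj 𝒜 hXY)).IsTwoSided := inferInstance
    exact idealGen_le (I := RingHom.ker (proj 𝒜 hXY))
      ((RingHom.mem_ker).2 ((proj_chi hXY 1 _).trans (chi_eq_zero 1 Set.disjoint_sdiff_left))) h

end CAlg

end ChiCalculus

section CAlgMap

variable {Γ K A A' : Type*} [DecidableEq Γ] [AddMonoid Γ] [Field K] [Ring A] [Algebra K A]
  [Ring A'] [Algebra K A'] (𝒜 : Γ → Submodule K A) [GradedAlgebra 𝒜] (𝒜' : Γ → Submodule K A')
  [GradedAlgebra 𝒜'] {S : Type*} [AddAction Γ S]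

/-- The homomorphism of the algebras `C(X)` induced by a homomorphism of graded algebras. -/
noncomputable def CAlg.map (X : Set S) (j : A' →ₐ[K] A) (hj : ∀ γ, ∀ a ∈ 𝒜' γ, j a ∈ 𝒜 γ) :
    CAlg 𝒜' X →ₐ[K] CAlg 𝒜 X :=
  Ideal.Quotient.liftₐ _ ((Ideal.Quotient.mkₐ K _).comp (SkewC.map 𝒜 𝒜' S j hj)) fun c hc => by
    refine Ideal.Quotient.eq_zero_iff_mem.2 ?_
    have h := map_mem_idealGen (SkewC.map 𝒜 𝒜' S j hj).toRingHom hc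
    rwa [show (SkewC.map 𝒜 𝒜' S j hj).toRingHom (tmulChi 𝒜' 1 Xᶜ) = tmulChi 𝒜 1 Xᶜ from
      (SkewC.map_tmulChi ..).trans (by rw [map_one])] at h

theorem CAlg.map_chi (X : Set S) (j : A' →ₐ[K] A) (hj : ∀ γ, ∀ a ∈ 𝒜' γ, j a ∈ 𝒜 γ) (a : A')
    (T : Set S) : CAlg.map 𝒜 𝒜' X j hj (chi 𝒜' X a T) = chi 𝒜 X (j a) T := rfl

end CAlgMap

/-! ### Triangular bases of the algebras `C(Y)` -/

section TriangularBasis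

variable {Γ K A : Type*} [DecidableEq Γ] [AddMonoid Γ] [Field K] [Ring A] [Algebra K A]
  {𝒜 : Γ → Submodule K A} [GradedAlgebra 𝒜] {S : Type*} [AddAction Γ S]

namespace CAlg

variable {X Y : Set S}

theorem chi_one_mul {γ : Γ} {a : A} (ha : a ∈ 𝒜 γ) (y : S) :
    chi 𝒜 X 1 {γ +ᵥ y} * chi 𝒜 X a {y} = chi 𝒜 X a {y} := by
  rw [chi_mul_chi_singleton 1 ha (Set.mem_singleton _), one_mul]

theorem chi_mul_singleton {γ : Γ} (a : A) {b : A} (hb : b ∈ 𝒜 γ) (y : S) :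
    chi 𝒜 X a {γ +ᵥ y} * chi 𝒜 X b {y} = chi 𝒜 X (a * b) {y} :=
  chi_mul_chi_singleton a hb rfl

theorem chi_mul_singleton_eq_zero {γ : Γ} (a : A) {b : A} (hb : b ∈ 𝒜 γ) {y : S}
    (hy : γ +ᵥ y ∉ X) : chi 𝒜 X (a * b) {y} = 0 := by
  rw [← chi_mul_singleton a hb, chi_singleton_eq_zero hb hy, mul_zero]

variable (𝒜) in
/-- The projection `C(Y) → C(X)` as a linear map. -/
noncomputable def projₗ (hXY : X ⊆ Y) : CAlg 𝒜 Y →ₗ[K] CAlg 𝒜 X where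
  __ := proj 𝒜 hXY
  map_smul' := proj_smul hXY

theorem projₗ_apply (hXY : X ⊆ Y) (x : CAlg 𝒜 Y) : projₗ 𝒜 hXY x = proj 𝒜 hXY x := rfl

end CAlg

open CAlg

variable {ι₁ ι₂ : Type*}

/-- The indices of the basis elements `α_i β_j χ_y` of `C(Y)`. -/
abbrev TriangularIndex (Y : Set S) (d₁ : ι₁ → Γ) (d₂ : ι₂ → Γ) (I : S → Set ι₂) : Type _ :=
  {p : S × ι₁ × ι₂ // p.1 ∈ Y ∧ p.2.2 ∈ I p.1 ∧ (d₁ p.2.1 + d₂ p.2.2) +ᵥ p.1 ∈ Y}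

variable (𝒜) in
/-- The elements `α_i β_j χ_y` form a basis of `C(Y)`, and the products of the elements `β_j χ_y`
are linear combinations of such elements. -/
structure TriangularBasis (Y : Set S) (α : ι₁ → A) (d₁ : ι₁ → Γ) (β : ι₂ → A) (d₂ : ι₂ → Γ)
    (I : S → Set ι₂) : Prop where
  left_mem : ∀ i, α i ∈ 𝒜 (d₁ i)
  right_mem : ∀ i, β i ∈ 𝒜 (d₂ i)
  vadd_mem : ∀ y ∈ Y, ∀ i ∈ I y, d₂ i +ᵥ y ∈ Y
  mul_mem : ∀ y ∈ Y, ∀ i ∈ I y, ∀ i' ∈ I (d₂ i +ᵥ y),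
    chi 𝒜 Y (β i' * β i) {y} ∈ Submodule.span K
      ((fun k => chi 𝒜 Y (β k) {y}) '' {k | k ∈ I y ∧ d₂ k +ᵥ y = d₂ i' +ᵥ (d₂ i +ᵥ y)})
  basis : IsBasisFamily K
    (fun p : TriangularIndex Y d₁ d₂ I => chi 𝒜 Y (α p.1.2.1 * β p.1.2.2) {p.1.1})

namespace TriangularBasis

variable {X Y : Set S} {α : ι₁ → A} {d₁ : ι₁ → Γ} {β : ι₂ → A} {d₂ : ι₂ → Γ} {I : S → Set ι₂}

variable (𝒜 Y α d₁ β d₂ I) in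
/-- The span of the basis elements `α_i β_j χ_y` with `deg(β_j) y ∈ W`. -/
noncomputable def midSpan (W : Set S) : Submodule K (CAlg 𝒜 Y) :=
  Submodule.span K ((fun p : TriangularIndex Y d₁ d₂ I =>
    chi 𝒜 Y (α p.1.2.1 * β p.1.2.2) {p.1.1}) '' {p | d₂ p.1.2.2 +ᵥ p.1.1 ∈ W})

variable (h : TriangularBasis 𝒜 Y α d₁ β d₂ I)

include h

theorem induction {P : CAlg 𝒜 Y → Prop} (zero : P 0) (add : ∀ x y, P x → P y → P (x + y))
    (smul : ∀ (c : K) x, P x → P (c • x))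
    (basis : ∀ y ∈ Y, ∀ j ∈ I y, ∀ i, (d₁ i + d₂ j) +ᵥ y ∈ Y → P (chi 𝒜 Y (α i * β j) {y}))
    (x : CAlg 𝒜 Y) : P x := by
  have hx : x ∈ Submodule.span K (Set.range fun p : TriangularIndex Y d₁ d₂ I =>
      chi 𝒜 Y (α p.1.2.1 * β p.1.2.2) {p.1.1}) := h.basis.2 ▸ Submodule.mem_top
  induction hx using Submodule.span_induction with
  | mem x hx =>
    obtain ⟨⟨⟨y, i, j⟩, hy, hj, hij⟩, rfl⟩ := hx
    exact basis y hy j hj i hij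
  | zero => exact zero
  | add x y _ _ hx hy => exact add x y hx hy
  | smul c x _ hx => exact smul c x hx

theorem mul_mem_deg (i : ι₁) (j : ι₂) : α i * β j ∈ 𝒜 (d₁ i + d₂ j) :=
  SetLike.GradedMul.mul_mem (h.left_mem i) (h.right_mem j)

theorem chi_mem_midSpan {W : Set S} {y : S} (hy : y ∈ Y) {j : ι₂} (hj : j ∈ I y)
    (hW : d₂ j +ᵥ y ∈ W) (i : ι₁) :
    chi 𝒜 Y (α i * β j) {y} ∈ midSpan 𝒜 Y α d₁ β d₂ I W := by
  by_cases hij : (d₁ i + d₂ j) +ᵥ y ∈ Y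
  · exact Submodule.subset_span ⟨⟨(y, i, j), hy, hj, hij⟩, hW, rfl⟩
  · rw [chi_singleton_eq_zero (h.mul_mem_deg i j) hij]
    exact zero_mem _

theorem mul_chi_one_mem_span (r : CAlg 𝒜 Y) (w : S) :
    r * chi 𝒜 Y 1 {w} ∈ Submodule.span K
      ((fun q : ι₁ × ι₂ => chi 𝒜 Y (α q.1 * β q.2) {w}) '' {q | q.2 ∈ I w}) := by
  induction r using h.induction with
  | zero => simp
  | add x y hx hy => rw [add_mul]; exact add_mem hx hy
  | smul c x hx => rw [smul_mul_assoc]; exact Submodule.smul_mem _ c hx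
  | basis y hy j hj i hij =>
    by_cases hyw : y = w
    · subst hyw
      rw [chi_mul_self]
      exact Submodule.subset_span ⟨(i, j), hj, rfl⟩
    · rw [chi_mul_singleton_of_ne _ hyw]
      exact zero_mem _

/-- Multiplication by `r` puts products `α_i β_j'` in front of `β_j χ_y`. The product `β_j' β_j χ_y`
is rewritten through `β_k χ_y` with the same target, and this target is in `W` because `W` is closed
under the `β_j'`. -/
theorem mul_chi_mem_midSpan {W : Set S} (hW : ∀ y ∈ Y, y ∈ W → ∀ j ∈ I y, d₂ j +ᵥ y ∈ W)
    {y : S} (hy : y ∈ Y) {j : ι₂} (hj : j ∈ I y) (hjW : d₂ j +ᵥ y ∈ W) (r : CAlg 𝒜 Y) :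
    r * chi 𝒜 Y (β j) {y} ∈ midSpan 𝒜 Y α d₁ β d₂ I W := by
  rw [← chi_one_mul (h.right_mem j), ← mul_assoc]
  refine Submodule.span_induction (p := fun x _ => x * chi 𝒜 Y (β j) {y} ∈ _) ?_ (by simp)
    (fun x y _ _ hx hy => by rw [add_mul]; exact add_mem hx hy)
    (fun c x _ hx => by rw [smul_mul_assoc]; exact Submodule.smul_mem _ c hx)
    (h.mul_chi_one_mem_span r (d₂ j +ᵥ y))
  rintro _ ⟨⟨i, j'⟩, hj' : j' ∈ I _, rfl⟩
  dsimp only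
  rw [chi_mul_singleton _ (h.right_mem j), mul_assoc,
    ← chi_mul_chi_singleton (T := {d₂ j' +ᵥ (d₂ j +ᵥ y)}) (α i)
      (SetLike.GradedMul.mul_mem (h.right_mem j') (h.right_mem j)) (by simp [add_vadd])]
  refine Submodule.span_induction (p := fun x _ => chi 𝒜 Y (α i) _ * x ∈ _) ?_ (by simp)
    (fun x y _ _ hx hy => by rw [mul_add]; exact add_mem hx hy)
    (fun c x _ hx => by rw [mul_smul_comm]; exact Submodule.smul_mem _ c hx)
    (h.mul_mem y hy j hj j' hj')
  rintro _ ⟨k, ⟨hk, hkj⟩, rfl⟩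
  dsimp only
  rw [← hkj, chi_mul_singleton _ (h.right_mem k)]
  refine h.chi_mem_midSpan hy hk ?_ i
  rw [hkj]
  exact hW _ (h.vadd_mem y hy j hj) hjW j' hj'

/-- If `α_i β_j χ_y` ends in `W`, its middle point is already in `W` by `hW'`; multiplication from
the left then keeps middle points in `W`. -/
theorem idealGen_le_midSpan {W : Set S} (hW : ∀ y ∈ Y, y ∈ W → ∀ j ∈ I y, d₂ j +ᵥ y ∈ W)
    (hW' : ∀ y ∈ Y, ∀ i, d₁ i +ᵥ y ∈ W → y ∈ W) {x : CAlg 𝒜 Y}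
    (hx : x ∈ idealGen (chi 𝒜 Y 1 W)) : x ∈ midSpan 𝒜 Y α d₁ β d₂ I W := by
  refine idealGen_induction (P := fun x => x ∈ midSpan 𝒜 Y α d₁ β d₂ I W)
    (fun _ _ => add_mem) (fun r r' => ?_) hx
  induction r' using h.induction with
  | zero => simp
  | add x y hx hy => rw [mul_add]; exact add_mem hx hy
  | smul c x hx => rw [mul_smul_comm]; exact Submodule.smul_mem _ c hx
  | basis y hy j hj i hij =>
    rw [mul_assoc]
    by_cases hijW : (d₁ i + d₂ j) +ᵥ y ∈ W
    · rw [chi_mul_chi_singleton 1 (h.mul_mem_deg i j) hijW, one_mul,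
        ← chi_mul_singleton _ (h.right_mem j), ← mul_assoc]
      refine h.mul_chi_mem_midSpan hW hy hj (hW' _ (h.vadd_mem y hy j hj) i ?_) _
      rwa [← add_vadd]
    · rw [chi_mul_chi_singleton_eq_zero 1 (h.mul_mem_deg i j) hijW, mul_zero]
      exact zero_mem _

end TriangularBasis

end TriangularBasis

/-! ### The free factorization of the ideal generated by `χ_z`. -/

section FreeFactorization

open CAlg

variable {Γ K A : Type*} [DecidableEq Γ] [AddMonoid Γ] [Field K] [Ring A] [Algebra K A]
  {𝒜 : Γ → Submodule K A} [GradedAlgebra 𝒜] {S : Type*} [AddAction Γ S] {ι₁ ι₂ : Type*}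
  {X Y : Set S} {α : ι₁ → A} {d₁ : ι₁ → Γ} {β : ι₂ → A} {d₂ : ι₂ → Γ} {I : S → Set ι₂}

namespace TriangularBasis

/-- The basis of `C(Y)` of the elements `α_i β_j χ_y`. -/
noncomputable def toBasis (h : TriangularBasis 𝒜 Y α d₁ β d₂ I) :
    Module.Basis (TriangularIndex Y d₁ d₂ I) K (CAlg 𝒜 Y) :=
  Module.Basis.mk h.basis.1 h.basis.2.ge

theorem toBasis_apply (h : TriangularBasis 𝒜 Y α d₁ β d₂ I) (p : TriangularIndex Y d₁ d₂ I) :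
    h.toBasis p = chi 𝒜 Y (α p.1.2.1 * β p.1.2.2) {p.1.1} :=
  Module.Basis.mk_apply ..

/-- The products `α_i' χ_z · β_j χ_y` with `deg(β_j) y = z` are themselves basis elements, so
coefficients can be read off. -/
theorem coord_mul [DecidableEq ι₁] (h : TriangularBasis 𝒜 Y α d₁ β d₂ I) {z : S} {x : CAlg 𝒜 Y}
    {c : {q : S × ι₂ // q.1 ∈ Y ∧ q.2 ∈ I q.1 ∧ d₂ q.2 +ᵥ q.1 = z} →₀ K}
    (hx : x = c.sum fun q t => t • chi 𝒜 Y (β q.1.2) {q.1.1}) (i i' : ι₁)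
    (hi' : d₁ i' +ᵥ z ∈ Y)
    (q : {q : S × ι₂ // q.1 ∈ Y ∧ q.2 ∈ I q.1 ∧ d₂ q.2 +ᵥ q.1 = z})
    (hq : (d₁ i + d₂ q.1.2) +ᵥ q.1.1 ∈ Y) :
    h.toBasis.coord ⟨(q.1.1, i, q.1.2), q.2.1, q.2.2.1, hq⟩
      (chi 𝒜 Y (α i') {z} * x) = if i = i' then c q else 0 := by
  have hv (q' : {q : S × ι₂ // q.1 ∈ Y ∧ q.2 ∈ I q.1 ∧ d₂ q.2 +ᵥ q.1 = z}) :
      chi 𝒜 Y (α i') {z} * chi 𝒜 Y (β q'.1.2) {q'.1.1} =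
        h.toBasis ⟨(q'.1.1, i', q'.1.2), q'.2.1, q'.2.2.1, by
          rwa [add_vadd, q'.2.2.2]⟩ := by
    rw [toBasis_apply, ← chi_mul_singleton _ (h.right_mem _)]
    dsimp only
    rw [q'.2.2.2]
  classical
  rw [hx, Finsupp.sum, Finset.mul_sum, map_sum]
  simp only [mul_smul_comm, map_smul, hv, Module.Basis.coord_apply, Module.Basis.repr_self,
    Finsupp.single_apply, Subtype.mk.injEq, Prod.mk.injEq, smul_eq_mul]
  by_cases hii : i = i'
  · subst hii
    simp only [true_and, if_true, ← Prod.mk.injEq, Prod.mk.eta, Subtype.coe_inj]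
    simp [eq_comm]
  · simp [hii, Ne.symm hii]

/-- The indices refer to `Y`, where the basis lives, but `h₁` forces `deg(α_i) z ∈ X` and `h₂`
forces `y ∈ X` for the elements that occur. The condition `hz₂` reduces `Re` to the `β_j` of degree
`0`, and `hz₁` puts `eR` into the left ideal generated by `U`. -/
theorem isFreeFactorization (hS : ∀ (γ₁ γ₂ : Γ) (x : S), γ₁ +ᵥ x = γ₂ +ᵥ x → γ₁ = γ₂)
    (h : TriangularBasis 𝒜 Y α d₁ β d₂ I) (hXY : X ⊆ Y) {z : S} (hz : z ∈ X)
    (h₁ : ∀ y ∈ Y, ∀ i, d₁ i +ᵥ y ∈ Y \ X → y ∈ Y \ X)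
    (h₂ : ∀ y ∈ Y \ X, ∀ j ∈ I y, d₂ j +ᵥ y ∈ Y \ X)
    (hz₁ : ∀ y ∈ X, ∀ i, d₁ i +ᵥ y = z → y = z)
    (hz₂ : ∀ j ∈ I z, d₂ j +ᵥ z ∈ X → d₂ j +ᵥ z = z) :
    IsFreeFactorization (chi 𝒜 X 1 {z})
      (fun i : {i : ι₁ // d₁ i +ᵥ z ∈ Y} => chi 𝒜 X (α i) {z})
      (Submodule.span K ((fun j => chi 𝒜 X (β j) {z}) '' {j | j ∈ I z ∧ d₂ j = 0})).toAddSubgroup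
      (Submodule.span K ((fun q : S × ι₂ => chi 𝒜 X (β q.2) {q.1}) ''
        {q | q.1 ∈ Y ∧ q.2 ∈ I q.1 ∧ d₂ q.2 +ᵥ q.1 = z})).toAddSubgroup where
  mul_idem i := chi_mul_self _ _
  idem_mul x hx := by
    refine Submodule.span_induction (p := fun x _ => chi 𝒜 X 1 {z} * x = x) ?_ (by simp)
      (fun x y _ _ hx hy => by rw [mul_add, hx, hy])
      (fun c x _ hx => by rw [mul_smul_comm, hx]) hx
    rintro _ ⟨q, ⟨_, _, hq⟩, rfl⟩
    dsimp only
    rw [← hq, chi_one_mul (h.right_mem _)]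
  mul_mem d hd x hx := by
    rw [Submodule.mem_toAddSubgroup] at hd hx ⊢
    induction hd using Submodule.span_induction with
    | zero => simp
    | add d d' _ _ hd hd' => rw [add_mul]; exact add_mem hd hd'
    | smul c d _ hd => rw [smul_mul_assoc]; exact Submodule.smul_mem _ c hd
    | mem d hd =>
      obtain ⟨j', ⟨hj', hj'0⟩, rfl⟩ := hd
      induction hx using Submodule.span_induction with
      | zero => simp
      | add d d' _ _ hd hd' => rw [mul_add]; exact add_mem hd hd'
      | smul c d _ hd => rw [mul_smul_comm]; exact Submodule.smul_mem _ c hd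
      | mem x hx =>
        obtain ⟨⟨y, j⟩, ⟨hy, hj, rfl⟩, rfl⟩ := hx
        dsimp only at hy hj hj' ⊢
        rw [chi_mul_singleton _ (h.right_mem j), ← proj_chi hXY, ← projₗ_apply]
        have := Submodule.mem_map_of_mem (f := projₗ 𝒜 hXY) (h.mul_mem y hy j hj j' hj')
        rw [Submodule.map_span] at this
        refine Submodule.span_mono ?_ this
        rintro _ ⟨_, ⟨k, ⟨hk, hkj⟩, rfl⟩, rfl⟩
        exact ⟨(y, k), ⟨hy, hk, by simp [hkj, hj'0]⟩, rfl⟩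
  exists_sum r := by
    obtain ⟨r, rfl⟩ := proj_surjective hXY r
    have hr := Submodule.mem_map_of_mem (f := projₗ 𝒜 hXY) (h.mul_chi_one_mem_span r z)
    rw [Submodule.map_span, projₗ_apply, map_mul, proj_chi] at hr
    generalize proj 𝒜 hXY r * chi 𝒜 X 1 {z} = x at hr
    induction hr using Submodule.span_induction with
    | zero => exact ⟨0, by simp⟩
    | add x y _ _ hx hy =>
      obtain ⟨f, hf, rfl⟩ := hx
      obtain ⟨g, hg, rfl⟩ := hy
      exact ⟨f + g, fun s => add_mem (hf s) (hg s),
        (Finsupp.sum_add_index' (by simp) (by simp [mul_add])).symm⟩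
    | smul c x _ hx =>
      obtain ⟨f, hf, rfl⟩ := hx
      refine ⟨f.mapRange (c • ·) (smul_zero c), fun s => Submodule.smul_mem _ c (hf s), ?_⟩
      rw [Finsupp.sum_mapRange_index (by simp), Finsupp.smul_sum]
      simp only [mul_smul_comm]
    | mem x hx =>
      obtain ⟨_, ⟨⟨i, j⟩, hj, rfl⟩, rfl⟩ := hx
      dsimp only at hj ⊢
      rw [projₗ_apply, proj_chi]
      by_cases hjX : d₂ j +ᵥ z ∈ X
      · have hj0 : d₂ j = 0 := hS _ _ z (by rw [hz₂ j hj hjX, zero_vadd])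
        by_cases hi : d₁ i +ᵥ z ∈ Y
        · refine ⟨Finsupp.single ⟨i, hi⟩ (chi 𝒜 X (β j) {z}), fun s => ?_, ?_⟩
          · classical
            rw [Finsupp.single_apply]
            split_ifs
            · exact Submodule.subset_span ⟨j, ⟨hj, hj0⟩, rfl⟩
            · exact zero_mem _
          · rw [Finsupp.sum_single_index (mul_zero _), ← chi_mul_singleton _ (h.right_mem j),
              hj0, zero_vadd]
        · refine ⟨0, fun _ => zero_mem _, ?_⟩
          rw [chi_singleton_eq_zero (h.mul_mem_deg i j), Finsupp.sum_zero_index]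
          rw [hj0, add_zero]
          exact fun hX => hi (hXY hX)
      · refine ⟨0, fun _ => zero_mem _, ?_⟩
        rw [chi_mul_singleton_eq_zero _ (h.right_mem j) hjX, Finsupp.sum_zero_index]
  mem_span r := by
    obtain ⟨r, rfl⟩ := proj_surjective hXY r
    induction r using h.induction with
    | zero => simp
    | add x y hx hy => rw [map_add, mul_add]; exact add_mem hx hy
    | smul c x hx =>
      rw [proj_smul, mul_smul_comm]
      exact Submodule.smul_of_tower_mem _ c hx
    | basis y hy j hj i hij =>
      rw [proj_chi]
      by_cases hijz : (d₁ i + d₂ j) +ᵥ y = z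
      · rw [show chi 𝒜 X 1 {z} * chi 𝒜 X (α i * β j) {y} = chi 𝒜 X (α i * β j) {y} by
          rw [← hijz, chi_one_mul (h.mul_mem_deg i j)]]
        by_cases hjX : d₂ j +ᵥ y ∈ X
        · rw [← chi_mul_singleton _ (h.right_mem j)]
          refine Ideal.mul_mem_left _ _ (Ideal.subset_span ?_)
          exact Submodule.subset_span ⟨(y, j), ⟨hy, hj, hz₁ _ hjX i (by rwa [← add_vadd])⟩, rfl⟩
        · rw [chi_mul_singleton_eq_zero _ (h.right_mem j) hjX]
          exact zero_mem _
      · rw [chi_mul_chi_singleton_eq_zero 1 (h.mul_mem_deg i j) hijz]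
        exact zero_mem _
  free f hf hf0 := by
    have hlift (s) : ∃ c : {q : S × ι₂ // q.1 ∈ Y ∧ q.2 ∈ I q.1 ∧ d₂ q.2 +ᵥ q.1 = z} →₀ K,
        f s = c.sum fun q t => t • chi 𝒜 X (β q.1.2) {q.1.1} := by
      have := hf s
      rw [Submodule.mem_toAddSubgroup, Set.image_eq_range,
        Finsupp.mem_span_range_iff_exists_finsupp] at this
      exact this.imp fun _ hc => hc.symm
    choose c hc using hlift
    let x (s) : CAlg 𝒜 Y := (c s).sum fun q t => t • chi 𝒜 Y (β q.1.2) {q.1.1}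
    have hx (s) : proj 𝒜 hXY (x s) = f s := by
      rw [hc, ← projₗ_apply, map_finsuppSum]
      rfl
    -- Lifted to `C(Y)`, the relation has only basis elements with middle point outside `X`. Its
    -- coordinates at middle point `z ∈ X`, which are the coefficients `c s q`, must vanish.
    have hmem := h.idealGen_le_midSpan (W := Y \ X) (fun y _ => h₂ y) h₁
      ((proj_eq_zero_iff hXY (∑ s ∈ f.support, chi 𝒜 Y (α s.1) {z} * x s)).1 (by
        rw [map_sum, ← hf0]
        simp only [map_mul, hx, proj_chi, Finsupp.sum]))
    suffices ∀ s ∈ f.support, c s = 0 by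
      ext s
      by_contra hs
      exact hs (by simp [hc s, this s (Finsupp.mem_support_iff.2 hs)])
    intro s hs
    classical
    ext q
    have hq : (d₁ s + d₂ q.1.2) +ᵥ q.1.1 ∈ Y := by rw [add_vadd, q.2.2.2]; exact s.2
    have hcoord := Submodule.span_induction
      (p := fun v _ => h.toBasis.coord
        ⟨(q.1.1, (s : ι₁), q.1.2), q.2.1, q.2.2.1, hq⟩ v = 0)
      (by
        rintro _ ⟨p, hp, rfl⟩
        dsimp only
        rw [Module.Basis.coord_apply, ← h.toBasis_apply p, Module.Basis.repr_self,
          Finsupp.single_eq_of_ne]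
        rintro rfl
        exact hp.2 (q.2.2.2.symm ▸ hz)) (map_zero _)
      (fun v w _ _ hv hw => by rw [map_add, hv, hw, add_zero])
      (fun c v _ hv => by rw [map_smul, hv, smul_zero]) hmem
    rw [map_sum, Finset.sum_congr rfl fun s' _ => h.coord_mul rfl s.1 s'.1 s'.2 q hq] at hcoord
    simpa [Subtype.coe_inj, Finsupp.mem_support_iff.1 hs] using hcoord

end TriangularBasis

end FreeFactorization

/-! ### Semisimple rings and idempotents in the Jacobson radical. -/

section RingTheory

theorem isSemisimpleRing_of_jacobson_eq_bot {R : Type*} [Ring R]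
    (h : IsSemisimpleRing (R ⧸ Ring.jacobson R)) (h0 : Ring.jacobson R = ⊥) :
    IsSemisimpleRing R := by
  have e : R ⧸ Ring.jacobson R ≃+* R :=
    RingEquiv.symm (RingEquiv.ofBijective (Ideal.Quotient.mk (Ring.jacobson R))
      ⟨(RingHom.injective_iff_ker_eq_bot _).2 (by rw [Ideal.mk_ker, h0]),
        Ideal.Quotient.mk_surjective⟩)
  exact e.isSemisimpleRing

/-- The left ideal `Ra` is generated by an idempotent `f = ba`, and right multiplication by `f`
fixes its elements. -/
theorem IsSemisimpleRing.exists_mul_mul_eq {R : Type*} [Ring R] [IsSemisimpleRing R] (a : R) :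
    ∃ b, a * b * a = a := by
  obtain ⟨f, hf, hspan⟩ := IsSemisimpleRing.ideal_eq_span_idempotent (Ideal.span {a})
  obtain ⟨b, hb⟩ := Ideal.mem_span_singleton'.1 (hspan ▸ Ideal.mem_span_singleton_self f)
  obtain ⟨c, hc⟩ := Ideal.mem_span_singleton'.1 (hspan ▸ Ideal.mem_span_singleton_self a)
  exact ⟨b, by rw [mul_assoc, hb, ← hc, mul_assoc, hf.eq]⟩

theorem IsIdempotentElem.eq_zero_of_mem_jacobson {R : Type*} [Ring R] {x : R}
    (hx : IsIdempotentElem x) (h : x ∈ Ring.jacobson R) : x = 0 := by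
  rw [← Ideal.jacobson_bot, Ideal.mem_jacobson_iff] at h
  -- The value `-1` yields a left inverse of `1 - x`, and `(1 - x) x = 0`.
  obtain ⟨z, hz⟩ := h (-1)
  have h1 : z * (1 - x) = 1 := by
    rw [Ideal.mem_bot] at hz
    rw [← sub_eq_zero, ← hz]
    noncomm_ring
  rw [← one_mul x, ← h1, mul_assoc, sub_mul, hx.eq, one_mul, sub_self, mul_zero]

end RingTheory

/-! ### The corner of `C(X)` at `χ_z`, heredity ideals, and the removal of one point. -/

section Corner

open CAlg

variable {Γ K A : Type*} [DecidableEq Γ] [AddMonoid Γ] [Field K] [Ring A] [Algebra K A]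
  {𝒜 : Γ → Submodule K A} [GradedAlgebra 𝒜] {S : Type*} [AddAction Γ S] {X Y : Set S}

variable (𝒜) in
/-- The homomorphism `a ↦ a χ_z` from `A_0` to the corner ring of `C(X)` at `χ_z`. -/
noncomputable def CAlg.corner (X : Set S) (z : S) : 𝒜 0 →ₙ+* CAlg 𝒜 X where
  toFun a := chi 𝒜 X a {z}
  map_mul' a b := (chi_mul_chi_singleton (a : A) b.2 (by simp)).symm
  map_zero' := (chiₗ 𝒜 X {z}).map_zero
  map_add' a b := (chiₗ 𝒜 X {z}).map_add a b

theorem tmul_mul_tmulChi_singleton (a : A) (b : S → K) (z : S) :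
    SkewProduct.tmul 𝒜 (mapsGammaAlgebra Γ K S) a b * tmulChi 𝒜 1 {z} = b z • tmulChi 𝒜 a {z} := by
  have hb : b * ({z} : Set S).indicator 1 = b z • ({z} : Set S).indicator (1 : S → K) := by
    ext x
    by_cases hx : x = z
    · simp [hx]
    · simp [hx]
  rw [tmulChi, SkewProduct.tmul_mul_tmul 𝒜 _ a b (SetLike.GradedOne.one_mem (A := 𝒜)), mul_one,
    GammaAlgebra.act_zero, hb]
  exact TensorProduct.tmul_smul _ _ _

/-- By effectiveness an element of nonzero degree moves `z`, so only degree `0` survives between two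
factors `χ_z`. -/
theorem CAlg.exists_corner_eq (hS : ∀ (γ₁ γ₂ : Γ) (x : S), γ₁ +ᵥ x = γ₂ +ᵥ x → γ₁ = γ₂) (z : S)
    (x : CAlg 𝒜 X) : ∃ a, corner 𝒜 X z a = chi 𝒜 X 1 {z} * x * chi 𝒜 X 1 {z} := by
  obtain ⟨x, rfl⟩ := Ideal.Quotient.mk_surjective x
  induction x using SkewProduct.induction 𝒜 with
  | zero => exact ⟨0, by rw [map_zero, map_zero, mul_zero, zero_mul]⟩
  | add x y hx hy =>
    obtain ⟨a, ha⟩ := hx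
    obtain ⟨b, hb⟩ := hy
    exact ⟨a + b, by rw [map_add, map_add, ha, hb, mul_add, add_mul]⟩
  | tmul γ a ha b =>
    have hmul : Ideal.Quotient.mk _ (SkewProduct.tmul 𝒜 _ a b) * chi 𝒜 X 1 {z} =
        b z • chi 𝒜 X a {z} :=
      congrArg (Ideal.Quotient.mk _) (tmul_mul_tmulChi_singleton a b z)
    rw [mul_assoc, hmul, mul_smul_comm]
    by_cases hγ : γ = 0
    · subst hγ
      refine ⟨⟨b z • a, Submodule.smul_mem _ _ ha⟩, ?_⟩
      rw [chi_mul_chi_singleton 1 ha (by simp), one_mul]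
      exact (chiₗ 𝒜 X {z}).map_smul (b z) a
    · refine ⟨0, ?_⟩
      rw [chi_mul_chi_singleton_eq_zero 1 ha, smul_zero, map_zero]
      exact fun h => hγ (hS _ _ z (by rwa [zero_vadd]))

/-- For `x` in the radical, `e x e = a χ_z` with `a` in degree `0`. If `a b a = a`, then `b a χ_z`
is an idempotent in the radical, hence zero, and so is `a χ_z = (a χ_z) (b a χ_z)`. -/
theorem CAlg.isHeredityIdeal [IsSemisimpleRing (𝒜 0)]
    (hS : ∀ (γ₁ γ₂ : Γ) (x : S), γ₁ +ᵥ x = γ₂ +ᵥ x → γ₁ = γ₂) (z : S)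
    (h : Module.Projective (CAlg 𝒜 X) (idealGen (chi 𝒜 X 1 {z}))) :
    IsHeredityIdeal (chi 𝒜 X 1 {z}) := by
  refine ⟨isIdempotentElem_chi _, fun x hx => ?_, h⟩
  obtain ⟨a, ha⟩ := exists_corner_eq hS z x
  rw [← ha]
  obtain ⟨b, hb⟩ := IsSemisimpleRing.exists_mul_mul_eq a
  have hmem : corner 𝒜 X z (b * a) ∈ Ring.jacobson (CAlg 𝒜 X) := by
    rw [map_mul, ha]
    exact Ideal.mul_mem_left _ _ (Ideal.mul_mem_right _ _ (Ideal.mul_mem_left _ _ hx))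
  have h0 := IsIdempotentElem.eq_zero_of_mem_jacobson (x := corner 𝒜 X z (b * a))
    (by rw [IsIdempotentElem, ← map_mul, mul_assoc, ← mul_assoc a, hb]) hmem
  rw [← hb, mul_assoc, map_mul, h0, mul_zero]

theorem CAlg.proj_mk (hXY : X ⊆ Y) (x : SkewC 𝒜 S) :
    proj 𝒜 hXY (Ideal.Quotient.mk _ x) = Ideal.Quotient.mk _ x := Ideal.Quotient.lift_mk _ _ _

theorem CAlg.proj_proj {X' : Set S} (hX : X ⊆ X') (hY : X' ⊆ Y) (x : CAlg 𝒜 Y) :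
    proj 𝒜 hX (proj 𝒜 hY x) = proj 𝒜 (hX.trans hY) x := by
  obtain ⟨x, rfl⟩ := Ideal.Quotient.mk_surjective x
  rw [proj_mk, proj_mk, proj_mk]

theorem CAlg.isStrongIdempotent_step {X' : Set S} (hX : X ⊆ X') (hY : X' ⊆ Y) {z : S}
    (hz : X' \ X = {z}) (hproj : Module.Projective (CAlg 𝒜 X') (idealGen (chi 𝒜 X' 1 {z})))
    (h : IsStrongIdempotent (idealGen (chi 𝒜 Y 1 (Y \ X')))) :
    IsStrongIdempotent (idealGen (chi 𝒜 Y 1 (Y \ X))) := by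
  refine h.comap (proj 𝒜 hY) (proj_surjective hY) (fun r => (proj_eq_zero_iff hY r).symm)
    (isIdempotentElem_chi {z}) fun r => ?_
  rw [← proj_eq_zero_iff (hX.trans hY), ← hz, ← proj_eq_zero_iff hX, proj_proj]

theorem CAlg.isStrongIdempotent_self : IsStrongIdempotent (idealGen (chi 𝒜 Y 1 (Y \ Y))) := by
  have h : idealGen (chi 𝒜 Y 1 (Y \ Y)) = ⊥ := by
    rw [Set.sdiff_self, chi_empty]
    exact le_bot_iff.1 (idealGen_le (zero_mem _))
  have key (J : Ideal (CAlg 𝒜 Y)) [J.IsTwoSided] (hJ : J = ⊥) : IsStrongIdempotent J := by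
    subst hJ
    exact isStrongIdempotent_bot
  exact key _ h

/-- Multiplying a spanning family by `χ_{γ y}` on the left and by `χ_y` on the right keeps exactly
the members from `y` to `γ y`. -/
theorem CAlg.chi_mem_span {ι : Type*} {β : ι → A} {d : ι → Γ} {I : S → Set ι}
    (hβ : ∀ i, β i ∈ 𝒜 (d i))
    (hspan : Submodule.span K (Set.range fun p : {p : S × ι // p.1 ∈ Y ∧ p.2 ∈ I p.1} =>
      chi 𝒜 Y (β p.1.2) {p.1.1}) = ⊤) {γ : Γ} {a : A} (ha : a ∈ 𝒜 γ) (y : S) :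
    chi 𝒜 Y a {y} ∈ Submodule.span K
      ((fun k => chi 𝒜 Y (β k) {y}) '' {k | k ∈ I y ∧ d k +ᵥ y = γ +ᵥ y}) := by
  suffices ∀ x : CAlg 𝒜 Y, chi 𝒜 Y 1 {γ +ᵥ y} * x * chi 𝒜 Y 1 {y} ∈ Submodule.span K
      ((fun k => chi 𝒜 Y (β k) {y}) '' {k | k ∈ I y ∧ d k +ᵥ y = γ +ᵥ y}) by
    simpa only [chi_one_mul ha, chi_mul_self] using this (chi 𝒜 Y a {y})
  intro x
  have hx : x ∈ (⊤ : Submodule K (CAlg 𝒜 Y)) := trivial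
  rw [← hspan] at hx
  induction hx using Submodule.span_induction with
  | zero => simp
  | add x x' _ _ hx hx' => rw [mul_add, add_mul]; exact add_mem hx hx'
  | smul c x _ hx => rw [mul_smul_comm, smul_mul_assoc]; exact Submodule.smul_mem _ c hx
  | mem x hx =>
    obtain ⟨⟨⟨w, k⟩, hw, hk⟩, rfl⟩ := hx
    dsimp only at hw hk ⊢
    by_cases hwy : w = y
    · subst hwy
      rw [mul_assoc, chi_mul_self]
      by_cases hkw : d k +ᵥ w = γ +ᵥ w
      · rw [chi_mul_chi_singleton 1 (hβ k) hkw, one_mul]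
        exact Submodule.subset_span ⟨k, ⟨hk, hkw⟩, rfl⟩
      · rw [chi_mul_chi_singleton_eq_zero 1 (hβ k) hkw]
        exact zero_mem _
    · rw [mul_assoc, chi_mul_singleton_of_ne _ hwy, mul_zero]
      exact zero_mem _

end Corner

/-! ### Passage from the graded factorization to the theorem. -/

theorem IsGradedProduct.triangularBasis {Γ K A A₁ A₂ S ι₁ ι₂ : Type*} [DecidableEq Γ]
    [AddMonoid Γ] [Field K] [Ring A] [Algebra K A] [Ring A₁] [Algebra K A₁] [Ring A₂] [Algebra K A₂] [AddAction Γ S]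
    {𝒜 : Γ → Submodule K A} [GradedAlgebra 𝒜] {𝒜₁ : Γ → Submodule K A₁}
    {𝒜₂ : Γ → Submodule K A₂} [GradedAlgebra 𝒜₂] {j₁ : A₁ →ₐ[K] A} {j₂ : A₂ →ₐ[K] A}
    (hA : IsGradedProduct 𝒜 𝒜₁ 𝒜₂ j₁ j₂) {J₁ : ι₁ → A₁} {d₁ : ι₁ → Γ}
    (hJ₁ : ∀ i, J₁ i ∈ 𝒜₁ (d₁ i))
    {J₂ : ι₂ → A₂} {d₂ : ι₂ → Γ} (hJ₂ : ∀ i, J₂ i ∈ 𝒜₂ (d₂ i)) {Y : Set S} {I : S → Set ι₂}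
    (hC₂ : IsBasisFamily K
      (fun p : {p : S × ι₂ // p.1 ∈ Y ∧ p.2 ∈ I p.1} =>
        CAlg.chi 𝒜₂ Y (J₂ p.1.2) {p.1.1}))
    (hC : IsBasisFamily K
      (fun p : {p : S × ι₁ × ι₂ // p.1 ∈ Y ∧ p.2.2 ∈ I p.1 ∧ (d₁ p.2.1 + d₂ p.2.2) +ᵥ p.1 ∈ Y} =>
        CAlg.chi 𝒜 Y (j₁ (J₁ p.1.2.1) * j₂ (J₂ p.1.2.2)) {p.1.1})) :
    TriangularBasis 𝒜 Y (fun i => j₁ (J₁ i)) d₁ (fun i => j₂ (J₂ i)) d₂ I where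
  left_mem i := hA.map_mem₁ _ _ (hJ₁ i)
  right_mem i := hA.map_mem₂ _ _ (hJ₂ i)
  -- If the target were outside `Y`, the basis element of `C_2(Y)` would be zero.
  vadd_mem y hy i hi := by
    by_contra h
    exact hC₂.1.ne_zero ⟨(y, i), hy, hi⟩ (CAlg.chi_singleton_eq_zero (hJ₂ i) h)
  mul_mem y hy i hi i' hi' := by
    -- The product is expanded in `C_2(Y)` and the expansion is carried over to `C(Y)`.
    have := Submodule.mem_map_of_mem (f := (CAlg.map 𝒜 𝒜₂ Y j₂ hA.map_mem₂).toLinearMap)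
      (CAlg.chi_mem_span hJ₂ hC₂.2 (SetLike.GradedMul.mul_mem (hJ₂ i') (hJ₂ i)) y)
    rwa [AlgHom.toLinearMap_apply, CAlg.map_chi, Submodule.map_span, Set.image_image, map_mul,
      add_vadd] at this
  basis := hC

theorem CAlg.exists_corner_eq_of_mem_span {Γ K A S ι : Type*} [DecidableEq Γ] [AddMonoid Γ]
    [Field K] [Ring A] [Algebra K A] {𝒜 : Γ → Submodule K A} [GradedAlgebra 𝒜] [AddAction Γ S]
    {X : Set S} {β : ι → A} {z : S} {J : Set ι} (hJ : ∀ j ∈ J, β j ∈ 𝒜 0) {x : CAlg 𝒜 X}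
    (hx : x ∈ Submodule.span K ((fun j => CAlg.chi 𝒜 X (β j) {z}) '' J)) :
    ∃ a, CAlg.corner 𝒜 X z a = x := by
  induction hx using Submodule.span_induction with
  | zero => exact ⟨0, map_zero _⟩
  | add x y _ _ hx hy =>
    obtain ⟨a, rfl⟩ := hx
    obtain ⟨b, rfl⟩ := hy
    exact ⟨a + b, map_add _ _ _⟩
  | smul c x _ hx =>
    obtain ⟨a, rfl⟩ := hx
    exact ⟨⟨c • a, Submodule.smul_mem _ c a.2⟩, (chiₗ 𝒜 X {z}).map_smul c a⟩
  | mem x hx =>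
    obtain ⟨j, hj, rfl⟩ := hx
    exact ⟨⟨β j, hJ j hj⟩, rfl⟩

theorem mainTheorem5 {Γ K A A₁ A₂ S ι₁ ι₂ : Type*} [DecidableEq Γ] [AddMonoid Γ] [Field K]
    [Ring A] [Algebra K A] [Ring A₁] [Algebra K A₁] [Ring A₂] [Algebra K A₂] [AddAction Γ S]
    -- `Γ` is a positive monoid acting effectively on `S`
    (hΓ : ∀ γ₁ γ₂ : Γ, γ₁ + γ₂ = 0 → γ₁ = 0 ∧ γ₂ = 0)
    (hS : ∀ (γ₁ γ₂ : Γ) (x : S), γ₁ +ᵥ x = γ₂ +ᵥ x → γ₁ = γ₂)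
    -- the graded algebra `A = A₁ ⊗ A₂`, with `Aᵢ` concentrated in degrees from `Γᵢ`
    (𝒜 : Γ → Submodule K A) [GradedAlgebra 𝒜] (𝒜₁ : Γ → Submodule K A₁) [GradedAlgebra 𝒜₁]
    (𝒜₂ : Γ → Submodule K A₂) [GradedAlgebra 𝒜₂] (j₁ : A₁ →ₐ[K] A) (j₂ : A₂ →ₐ[K] A)
    (hA : IsGradedProduct 𝒜 𝒜₁ 𝒜₂ j₁ j₂) (Γ₁ Γ₂ : AddSubmonoid Γ)
    (hΓ₁ : ∀ γ, γ ∉ Γ₁ → 𝒜₁ γ = ⊥) (hΓ₂ : ∀ γ, γ ∉ Γ₂ → 𝒜₂ γ = ⊥)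
    -- homogeneous bases `J₁`, `J₂` of `A₁`, `A₂`, with their degrees
    (J₁ : Module.Basis ι₁ K A₁) (d₁ : ι₁ → Γ) (hJ₁ : ∀ i, J₁ i ∈ 𝒜₁ (d₁ i))
    (J₂ : Module.Basis ι₂ K A₂) (d₂ : ι₂ → Γ) (hJ₂ : ∀ i, J₂ i ∈ 𝒜₂ (d₂ i))
    -- the subsets `X ⊆ Y` of `S`, and the subsets `I y` of `J₂`
    (X Y : Set S) (hXY : X ⊆ Y) (I : S → Set ι₂)
    (hC₂ : IsBasisFamily K
      (fun p : {p : S × ι₂ // p.1 ∈ Y ∧ p.2 ∈ I p.1} =>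
        CAlg.chi 𝒜₂ Y (J₂ p.1.2) {p.1.1}))
    (hC : IsBasisFamily K
      (fun p : {p : S × ι₁ × ι₂ // p.1 ∈ Y ∧ p.2.2 ∈ I p.1 ∧ (d₁ p.2.1 + d₂ p.2.2) +ᵥ p.1 ∈ Y} =>
        CAlg.chi 𝒜 Y (j₁ (J₁ p.1.2.1) * j₂ (J₂ p.1.2.2)) {p.1.1}))
    (hX : ((Γ₁ : Set Γ) +ᵥ X) ∩ Y = X)
    (hZ : ((Γ₂ : Set Γ) +ᵥ (Y \ X)) ∩ Y = Y \ X)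
    -- the enumeration of `Z = Y \ X`
    (m : ℕ) (z : Fin m → S) (hz : Function.Injective z) (hzZ : Set.range z = Y \ X)
    (hz₂ : ∀ i j, i ≠ j → SubmonoidLE Γ₂ (z i) (z j) → i < j)
    (hz₁ : ∀ i j, i ≠ j → SubmonoidLE Γ₁ (z i) (z j) → j < i) :
    (∀ k : Fin m,
      IsKIdempotent 2 (idealGen (CAlg.chi 𝒜 (X ∪ z '' Set.Iic k) 1 {z k}))) ∧
    (IsSemisimpleRing (𝒜 0 ⧸ Ring.jacobson (𝒜 0)) → Ring.jacobson (𝒜 0) = ⊥ →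
      (∀ k : Fin m, IsHeredityIdeal (CAlg.chi 𝒜 (X ∪ z '' Set.Iic k) 1 {z k})) ∧
      IsStrongIdempotent (idealGen (CAlg.chi 𝒜 Y 1 (Y \ X)))) := by
  have hT := hA.triangularBasis hJ₁ hJ₂ hC₂ hC
  have hd₁ (i) : d₁ i ∈ Γ₁ := by
    by_contra h
    exact J₁.ne_zero i (by simpa [hΓ₁ _ h] using hJ₁ i)
  have hd₂ (j) : d₂ j ∈ Γ₂ := by
    by_contra h
    exact J₂.ne_zero j (by simpa [hΓ₂ _ h] using hJ₂ j)
  have hX₁ (y) (hy : y ∈ X) (i) (hi : d₁ i +ᵥ y ∈ Y) : d₁ i +ᵥ y ∈ X :=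
    hX ▸ ⟨Set.vadd_mem_vadd (hd₁ i) hy, hi⟩
  have hZ₂ (y) (hy : y ∈ Y \ X) (j) (hj : j ∈ I y) : d₂ j +ᵥ y ∈ Y \ X :=
    hZ ▸ ⟨Set.vadd_mem_vadd (hd₂ j) hy, hT.vadd_mem y hy.1 j hj⟩
  have hzmem (i) : z i ∈ Y \ X := hzZ ▸ Set.mem_range_self i
  have hex (y) (hy : y ∈ Y \ X) : ∃ i, z i = y := by rwa [← hzZ] at hy
  have hle₁ (i l k) (h : d₁ i +ᵥ z l = z k) : k ≤ l := by
    by_contra hkl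
    exact hkl (hz₁ l k (ne_of_not_ge hkl) ⟨_, hd₁ i, h.symm⟩).le
  have hle₂ (j l k) (h : d₂ j +ᵥ z l = z k) : l ≤ k := by
    by_contra hlk
    exact hlk (hz₂ l k (ne_of_not_ge hlk).symm ⟨_, hd₂ j, h.symm⟩).le
  have hmemX (k l) : z l ∈ X ∪ z '' Set.Iic k ↔ l ≤ k := by
    rw [Set.mem_union, hz.mem_set_image]
    exact or_iff_right (hzmem l).2
  have hXkY (k) : X ∪ z '' Set.Iic k ⊆ Y :=
    Set.union_subset hXY (Set.image_subset_iff.2 fun i _ => (hzmem i).1)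
  have hsub (k) : X ⊆ X ∪ z '' Set.Iic k := Set.subset_union_left
  -- The complement `Y \ X_k` is `{z_l : l > k}`. By `hle₁` the `α_i` do not raise the index, and by
  -- `hle₂` the `β_j` do not lower it. This gives the two closure conditions and, inside `X_k`,
  -- makes `z_k` the only point that an `α_i` sends to `z_k` and the only one that a `β_j` with `j ∈
  -- I (z_k)` reaches from `z_k`.
  have key (k) := hT.isFreeFactorization hS (hXkY k) ((hmemX k k).2 le_rfl)
    (fun y hy i hi => by
      by_cases hyX : y ∈ X
      · exact absurd (hsub k (hX₁ y hyX i hi.1)) hi.2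
      · obtain ⟨l, rfl⟩ := hex y ⟨hy, hyX⟩
        obtain ⟨l', hl'⟩ := hex _ ⟨hi.1, fun h => hi.2 (hsub k h)⟩
        rw [← hl', Set.mem_sdiff, hmemX] at hi
        exact ⟨hy, fun h => hi.2 ((hle₁ i l l' hl'.symm).trans ((hmemX k l).1 h))⟩)
    (fun y hy j hj => by
      obtain ⟨l, rfl⟩ := hex y ⟨hy.1, fun h => hy.2 (hsub k h)⟩
      have hm := hZ₂ _ (hzmem l) j hj
      refine ⟨hm.1, fun h => hy.2 ((hmemX k l).2 ?_)⟩
      obtain ⟨l', hl'⟩ := hex _ hm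
      rw [← hl', hmemX] at h
      exact (hle₂ j l l' hl'.symm).trans h)
    (fun y hy i hi => by
      rcases hy with hy | ⟨l, hl, rfl⟩
      · exact absurd (hi ▸ hX₁ y hy i (hi ▸ (hzmem k).1)) (hzmem k).2
      · rw [le_antisymm hl (hle₁ i l k hi)])
    (fun j hj h => by
      obtain ⟨l, hl⟩ := hex _ (hZ₂ _ (hzmem k) j hj)
      rw [← hl, hmemX] at h
      rw [← hl, le_antisymm h (hle₂ j k l hl.symm)])
  refine ⟨fun k => (key k).isKIdempotent_two (CAlg.isIdempotentElem_chi _), fun hss h0 => ?_⟩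
  have := isSemisimpleRing_of_jacobson_eq_bot hss h0
  -- Only the inclusion of `D` in `A_0 χ_z` matters, so semisimplicity of `A_0` suffices and nothing
  -- is needed about the degree `0` part of `A₂`.
  have hproj (k) := (key k).projective_idealGen (CAlg.corner 𝒜 _ (z k)) rfl fun d hd =>
    CAlg.exists_corner_eq_of_mem_span (fun j hj => hj.2 ▸ hT.right_mem j) hd
  refine ⟨fun k => CAlg.isHeredityIdeal hS _ (hproj k), ?_⟩
  -- Descending from `n = m`, where the set is `Y` and the ideal is zero, to `n = 0`, where it is
  -- `X`. Indices start at `0`, so `{i < n + 1}` is `Set.Iic n`, and this step removes the point `z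
  -- n`.
  have chain (n : ℕ) (hn : n ≤ m) :
      IsStrongIdempotent (idealGen (CAlg.chi 𝒜 Y 1 (Y \ (X ∪ z '' {i | i < n})))) := by
    induction hn using Nat.decreasingInduction with
    | self =>
      have h : X ∪ z '' {i | i < m} = Y := by
        simp [hzZ, hXY]
      rw [h]
      exact CAlg.isStrongIdempotent_self
    | of_succ n hn ih =>
      have h : X ∪ z '' {i | i < n + 1} = X ∪ z '' Set.Iic ⟨n, hn⟩ := by
        congr 2
        ext i
        simp [Fin.le_def]
      rw [h] at ih
      refine CAlg.isStrongIdempotent_step (z := z ⟨n, hn⟩) (Set.union_subset_union_right _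
        (Set.image_mono fun i hi => Fin.le_def.2 hi.le)) (hXkY _) ?_ (hproj _) ih
      ext x
      simp only [Set.mem_sdiff, Set.mem_union, not_or, Set.mem_singleton_iff]
      constructor
      · rintro ⟨hx | ⟨i, hi, rfl⟩, hxX, hxn⟩
        · exact absurd hx hxX
        · have hin : ¬ i.1 < n := fun h => hxn ⟨i, h, rfl⟩
          exact congrArg z (Fin.ext (le_antisymm (Fin.le_def.1 hi) (not_lt.1 hin)))
      · rintro rfl
        exact ⟨Or.inr ⟨_, Set.mem_Iic.2 le_rfl, rfl⟩, (hzmem _).2,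
          fun ⟨i, hi, hiz⟩ => hi.ne (Fin.ext_iff.1 (hz hiz))⟩
  simpa using chain 0 m.zero_le
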